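/- Let $\Omega\subset\mathbb R^2$ be a bounded polygonal domain with $\Omega=\operatorname{int}\overline\Omega$ (for example, one with Lipschitz boundary), let $\alpha_0<\pi$ and $C_0\in\mathbb R$. Let $u\in W^{2,\infty}(\Omega)$, identified with its representative that is continuous on $\overline\Omega$, and let $f\in L^2(\Omega)$ be such that $-\Delta u=f$ weakly, i.e. $a(u,v):=\int_\Omega\nabla u\cdot\nabla v\,dx=\int_\Omega fv\,dx$ for all $v\in H^1_0(\Omega)$. For a nondegenerate triangle $K$ with vertices $A_K,B_K,C_K$, labelled so that the maximum angle $\alpha_K$ is at $A_K$, put $h_K=\operatorname{diam}K$ and $r_K=\tfrac12\min\{|A_K-B_K|,|A_K-C_K|\}$. For a conforming triangulation $\mathcal T_h$ of $\overline\Omega$ let $h=\max_{K\in\mathcal T_h}h_K$, let $X_h$ be the space of functions that are continuous on $\overline\Omega$ and affine on each $K\in\mathcal T_h$, let $V_h=X_h\cap H^1_0(\Omega)$, and write $|v|_1=\|\nabla v\|_{L^2(\Omega)}$. For $g_h\in X_h$, a finite element solution with Dirichlet lift $g_h$ is a function $U\in X_h$ with $U-g_h\in V_h$ and $a(U,v_h)=\int_\Omega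 fv_h\,dx$ for all $v_h\in V_h$. Then there is a constant $C=C(u)$, which depends only on $\Omega,\alpha_0,C_0,u$ and not on the triangulation, such that the following holds for every conforming triangulation $\mathcal T_h$ of $\overline\Omega$ with a splitting $\mathcal T_h=\mathcal T_h^1\cup\mathcal T_h^2$ into disjoint subsets for which $\alpha_K\le\alpha_0$ for all $K\in\mathcal T_h^1$ and (i) $\sum_{K\in\mathcal T_h^2}h_K^2\le C_0$, (ii) $|A_K-A_{K'}|\ge r_K+r_{K'}$ for all $K\ne K'$ in $\mathcal T_h^2$, (iii) $|A_K-B_{K'}|\ge r_K$ and $|A_K-C_{K'}|\ge r_K$ for all $K,K'\in\mathcal T_h^2$. There is a discrete Dirichlet datum $g_h^0\in X_h$ such that, at vertices $P$ of $\mathcal T_h$ on $\partial\Omega$, $g_h^0(P)=u(P)$ whenever $|P-A_K|\ge r_K$ for all $K\in\mathcal T_h^2$, and $|g_h^0(P)-u(P)|\le C h_K^2$ whenever $|P-A_K|<r_K$ for some $K\in\mathcal T_h^2$; and for every $g_h\in X_h$ with $g_h=g_h^0$ on $\partial\Omega$ a finite element solution with lift $g_h$ exists and every such solution $U$ satisfies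 $$|u-U|_1\le C\,h .$$ In particular, if $|P-A_K|\ge r_K$ for all $K\in\mathcal T_h^2$ and all vertices $P\in\partial\Omega$, then $g_h^0$ is the piecewise linear Lagrange interpolation of $u$ on $\partial\Omega$; and in all cases $\inf_{v_h\in X_h}|u-v_h|_1\le C\,h$. -/

import Mathlib

open MeasureTheory Filter Topology
open scoped ContDiff ENNReal

noncomputable section

namespace FEM

/-- The Euclidean plane. -/
abbrev Plane : Type := EuclideanSpace ℝ (Fin 2)

/-! ### Sobolev spaces through weak derivatives -/

/-- Test functions on `Ω`: the space `C_c^∞(Ω)`. -/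
def IsTest (Ω : Set Plane) (φ : Plane → ℝ) : Prop :=
  ContDiff ℝ ∞ φ ∧ HasCompactSupport φ ∧ tsupport φ ⊆ Ω

/-- `G` is a weak gradient of `v` on the open set `Ω`. -/
def IsWeakGrad (Ω : Set Plane) (v : Plane → ℝ) (G : Plane → Plane) : Prop :=
  LocallyIntegrableOn v Ω ∧ LocallyIntegrableOn G Ω ∧
    ∀ φ : Plane → ℝ, IsTest Ω φ → ∀ i : Fin 2,
      ∫ x in Ω, v x * fderiv ℝ φ x (EuclideanSpace.single i 1) = - ∫ x in Ω, G x i * φ x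

open Classical in
/-- The weak gradient of `v` on `Ω` (unique up to null sets); `0` if there is none. -/
def weakGrad (Ω : Set Plane) (v : Plane → ℝ) : Plane → Plane :=
  if h : ∃ G, IsWeakGrad Ω v G then h.choose else 0

/-- `v ∈ H¹(Ω)`. -/
def MemH1 (Ω : Set Plane) (v : Plane → ℝ) : Prop :=
  MemLp v 2 (volume.restrict Ω) ∧
    ∃ G, IsWeakGrad Ω v G ∧ MemLp G 2 (volume.restrict Ω)

/-- `v ∈ H¹₀(Ω)`: the closure of `C_c^∞(Ω)` in `H¹(Ω)`. -/
def MemH10 (Ω : Set Plane) (v : Plane → ℝ) : Prop :=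
  MemH1 Ω v ∧ ∃ φ : ℕ → Plane → ℝ, (∀ n, IsTest Ω (φ n)) ∧
    Tendsto (fun n => eLpNorm (fun x => v x - φ n x) 2 (volume.restrict Ω)) atTop (𝓝 0) ∧
    Tendsto (fun n => eLpNorm (fun x => weakGrad Ω v x - gradient (φ n) x) 2
      (volume.restrict Ω)) atTop (𝓝 0)

/-- `v ∈ W^{2,∞}(Ω)`. -/
def MemW2Inf (Ω : Set Plane) (v : Plane → ℝ) : Prop :=
  MemLp v ∞ (volume.restrict Ω) ∧
    ∃ G, IsWeakGrad Ω v G ∧ MemLp G ∞ (volume.restrict Ω) ∧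
      ∀ i : Fin 2, ∃ H, IsWeakGrad Ω (fun x => G x i) H ∧ MemLp H ∞ (volume.restrict Ω)

/-- The bilinear form `a(v, w) = ∫_Ω ∇v · ∇w`. -/
def bilin (Ω : Set Plane) (v w : Plane → ℝ) : ℝ :=
  ∫ x in Ω, inner ℝ (weakGrad Ω v x) (weakGrad Ω w x)

/-- The seminorm `|v|_1 = (∫_Ω |∇v|²)^{1/2}` of `v ∈ H¹(Ω)`. -/
def h1Seminorm (Ω : Set Plane) (v : Plane → ℝ) : ℝ :=
  √(∫ x in Ω, ‖weakGrad Ω v x‖ ^ 2)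

/-- `u` is a weak solution of `-Δu = f` in `Ω` (with its own trace as Dirichlet datum). -/
def IsWeakSolution (Ω : Set Plane) (f u : Plane → ℝ) : Prop :=
  MemH1 Ω u ∧ ∀ v, MemH10 Ω v → bilin Ω u v = ∫ x in Ω, f x * v x

/-! ### Triangles and triangulations -/

/-- A nondegenerate triangle whose vertices are labelled so that its maximum angle is at `A`
(any such labelling is allowed if the maximum is attained more than once). -/
structure Triangle where
  A : Plane
  B : Plane
  C : Plane
  indep : AffineIndependent ℝ ![A, B, C]
  angle_B_le : EuclideanGeometry.angle A B C ≤ EuclideanGeometry.angle B A C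
  angle_C_le : EuclideanGeometry.angle A C B ≤ EuclideanGeometry.angle B A C

namespace Triangle

/-- The set of vertices. -/
def verts (K : Triangle) : Set Plane := {K.A, K.B, K.C}

/-- The closed triangle. -/
def carrier (K : Triangle) : Set Plane := convexHull ℝ K.verts

/-- The maximum angle `α_K`. -/
def maxAngle (K : Triangle) : ℝ := EuclideanGeometry.angle K.B K.A K.C

/-- The diameter `h_K`. -/
def diam (K : Triangle) : ℝ := Metric.diam K.carrier

/-- The radius `r_K`: half the distance from `A_K` to the nearer of the other two vertices. -/
def radius (K : Triangle) : ℝ := 1 / 2 * min (dist K.A K.B) (dist K.A K.C)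

end Triangle

/-- A conforming triangulation of (the closure of) `Ω`. -/
structure Triangulation (Ω : Set Plane) where
  elements : Finset Triangle
  cover : ⋃ K ∈ elements, K.carrier = closure Ω
  disjoint_interior : ∀ K ∈ elements, ∀ K' ∈ elements, K ≠ K' →
    Disjoint (interior K.carrier) (interior K'.carrier)
  /-- Two different elements meet in the empty set, a common vertex or a common edge. -/
  conforming : ∀ K ∈ elements, ∀ K' ∈ elements, K ≠ K' →
    K.carrier ∩ K'.carrier = convexHull ℝ (K.verts ∩ K'.verts)

namespace Triangulation

variable {Ω : Set Plane}

/-- The mesh size `h`: the maximal diameter of the elements. -/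
def meshSize (T : Triangulation Ω) : ℝ := sSup (Triangle.diam '' (T.elements : Set Triangle))

/-- The vertices of the triangulation that lie on the boundary of `Ω`. -/
def boundaryVerts (T : Triangulation Ω) : Set Plane :=
  {P | P ∈ frontier Ω ∧ ∃ K ∈ T.elements, P ∈ K.verts}

/-- `v ∈ X_h`: continuous on `closure Ω` and affine on every element. (Values outside
`closure Ω` are irrelevant.) -/
def MemX (T : Triangulation Ω) (v : Plane → ℝ) : Prop :=
  ContinuousOn v (closure Ω) ∧
    ∀ K ∈ T.elements, ∃ l : Plane →ᵃ[ℝ] ℝ, Set.EqOn v l K.carrier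

/-- `v ∈ V_h = X_h ∩ H¹₀(Ω)`. -/
def MemV (T : Triangulation Ω) (v : Plane → ℝ) : Prop := T.MemX v ∧ MemH10 Ω v

/-- `U` is the finite element solution for the right-hand side `f` and the discrete Dirichlet
lift `g ∈ X_h`: `U ∈ g + V_h` and `a(U, v) = (f, v)` for all `v ∈ V_h`. -/
def IsFEMSolution (T : Triangulation Ω) (f g U : Plane → ℝ) : Prop :=
  T.MemX U ∧ T.MemV (fun x => U x - g x) ∧
    ∀ v, T.MemV v → bilin Ω U v = ∫ x in Ω, f x * v x

/-- The conditions on the set `T₂` of possibly degenerate elements: `Σ h_K² ≤ C₀`, the open disks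
of radius `r_K` around the maximum-angle vertices `A_K` are pairwise disjoint, and none of them
contains a vertex `B_{K'}` or `C_{K'}`. -/
structure Separated (T₂ : Finset Triangle) (C₀ : ℝ) : Prop where
  sum_le : ∑ K ∈ T₂, K.diam ^ 2 ≤ C₀
  dist_A : ∀ K ∈ T₂, ∀ K' ∈ T₂, K ≠ K' → K.radius + K'.radius ≤ dist K.A K'.A
  dist_B : ∀ K ∈ T₂, ∀ K' ∈ T₂, K.radius ≤ dist K.A K'.B
  dist_C : ∀ K ∈ T₂, ∀ K' ∈ T₂, K.radius ≤ dist K.A K'.C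

/-- `g ∈ X_h` is a discrete Dirichlet datum for `u` adapted to `T₂`, with constant `C`: at the
boundary vertices it interpolates `u`, except that at those boundary vertices which lie in the disk
of radius `r_K` around `A_K` for some `K ∈ T₂` a perturbation of size `C h_K²` is allowed. -/
structure IsAdaptedDatum (T : Triangulation Ω) (T₂ : Finset Triangle) (u : Plane → ℝ) (C : ℝ)
    (g : Plane → ℝ) : Prop where
  memX : T.MemX g
  interp : ∀ P ∈ T.boundaryVerts, (∀ K ∈ T₂, K.radius ≤ dist P K.A) → g P = u P
  near : ∀ P ∈ T.boundaryVerts, ∀ K ∈ T₂, dist P K.A < K.radius → |g P - u P| ≤ C * K.diam ^ 2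

end Triangulation

end FEM

end

namespace FEM

/-! ### Lipschitz functions -/

/-! By Galerkin orthogonality, `U` is at least as close to `u` in the energy seminorm as any `w ∈
X_h` with `U - w ∈ V_h` (`IsFEMSolution.h1Seminorm_sub_le`). It therefore suffices to build one `w`
whose gradient error is `O(h)` and to use its boundary values as the discrete datum.

On triangles whose maximum angle stays away from `π`, difference quotients along the two edges at
`A_K` control the whole gradient (`norm_affineGrad_sub_le`), so Lagrange interpolation is accurate.
On a degenerate triangle it may fail, but shifting the single value at `A_K` by some `δ_K = O(h_K
r_K)` makes the gradient accurate whatever the shape (`exists_perturbation`). The shifts are spread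
by tents of radius `r_K` around `A_K`. Separation makes the tents disjoint and makes them vanish at
every `B_{K'}` and `C_{K'}`, so a degenerate triangle feels only its own shift. A tent of height
`O(h_K r_K)` has slope `O(h_K)`; good triangles nearby thus gain a gradient error `O(h_K)`, confined
to the ball of radius `2h` about `A_K`. The squares integrate to `O(h² Σ h_K²) = O(C₀ h²)`
(`exists_approx`, `integral_norm_sub_gradient_le`).

The local input is that `u` is linear on each element up to a Lipschitz error `O(h_K)`, which
follows by mollification (`exists_gradient_approx`). The remaining work connects `X_h` with the weak
definitions: weak differentiability (`MemX.isWeakGrad`), membership in `H¹₀` (`MemX.memH10`), and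
Friedrichs' inequality for solvability. -/

lemma abs_sub_le_of_finite_closed_cover_Icc {ι : Type*} [Finite ι] {F : ι → Set ℝ}
    (hF : ∀ i, IsClosed (F i)) (hcov : ∀ t, ∃ i, t ∈ F i) {f : ℝ → ℝ} (hf : Continuous f) {C : ℝ}
    (hL : ∀ i, ∀ s ∈ F i, ∀ t ∈ F i, |f s - f t| ≤ C * |s - t|) {a b : ℝ} (hab : a ≤ b) :
    |f b - f a| ≤ C * (b - a) := by
  have key : Set.Icc a b ⊆ {t | |f t - f a| ≤ C * (t - a)} := by
    refine IsClosed.Icc_subset_of_forall_exists_gt ?_ (by simp) ?_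
    · exact (isClosed_le (by fun_prop) (by fun_prop)).inter isClosed_Icc
    · rintro x ⟨hx, hxab⟩ y hy
      have hxy : x < y := hy
      -- The cover is finite, so one member accumulates at `x` from the right; being closed it
      -- contains `x`, and its Lipschitz bound carries the estimate past `x`.
      have h1 : ∃ i, ∃ᶠ s in 𝓝[>] x, s ∈ F i := by
        by_contra! hcon
        have := eventually_all.2 hcon
        obtain ⟨s, hs⟩ := this.exists
        obtain ⟨i, hi⟩ := hcov s
        exact hs i hi
      obtain ⟨i, hi⟩ := h1
      have hxi : x ∈ F i := by
        rw [← (hF i).closure_eq, mem_closure_iff_frequently]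
        exact hi.filter_mono nhdsWithin_le_nhds
      obtain ⟨s, hs, hsxy⟩ := (hi.and_eventually (Ioc_mem_nhdsGT hxy)).exists
      refine ⟨s, ?_, hsxy⟩
      have h2 := hL i s hs x hxi
      rw [abs_of_pos (sub_pos.2 hsxy.1)] at h2
      have h3 : |f x - f a| ≤ C * (x - a) := hx
      change |f s - f a| ≤ C * (s - a)
      have := abs_sub_le (f s) (f x) (f a)
      linarith
  exact key ⟨hab, le_rfl⟩

/-- A function that is `C`-Lipschitz on each member of a finite closed cover is `C`-Lipschitz. -/
lemma lipschitzWith_of_finite_closed_cover {E : Type*} [NormedAddCommGroup E] [NormedSpace ℝ E]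
    {ι : Type*} [Finite ι] {F : ι → Set E} (hF : ∀ i, IsClosed (F i))
    (hcov : ∀ x, ∃ i, x ∈ F i) {f : E → ℝ} {C : NNReal}
    (hL : ∀ i, LipschitzOnWith C f (F i)) : LipschitzWith C f := by
  have hc : Continuous f := by
    refine (locallyFinite_of_finite F).continuous (Set.iUnion_eq_univ_iff.2 hcov) hF
      fun i => (hL i).continuousOn
  refine LipschitzWith.of_dist_le_mul fun x y => ?_
  have h := abs_sub_le_of_finite_closed_cover_Icc (F := fun i => (fun t : ℝ => y + t • (x - y)) ⁻¹' F i)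
    (fun i => (hF i).preimage (by fun_prop)) (fun t => hcov _)
    (f := fun t => f (y + t • (x - y))) (by fun_prop) (C := C * dist x y)
    (fun i s hs t ht => by
      have h := (hL i).dist_le_mul _ hs _ ht
      rw [Real.dist_eq] at h
      refine h.trans (le_of_eq ?_)
      rw [dist_add_left, dist_eq_norm, ← sub_smul, norm_smul, Real.norm_eq_abs, dist_eq_norm]
      ring) zero_le_one
  simpa [Real.dist_eq] using h

/-- Integration by parts for Lipschitz functions, against a bump equal to 1 near the support of `w`.
-/
lemma integral_lineDeriv_eq_zero {w : Plane → ℝ} {C : NNReal} (hw : LipschitzWith C w)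
    (hc : HasCompactSupport w) (v : Plane) : ∫ x, lineDeriv ℝ w x v = 0 := by
  obtain ⟨R, hR⟩ := hc.isBounded.subset_closedBall (0 : Plane)
  let b : ContDiffBump (0 : Plane) := ⟨max R 0 + 1, max R 0 + 2, by positivity, by linarith⟩
  have hb1 : ∀ x ∈ tsupport w, b =ᶠ[𝓝 x] fun _ => 1 := by
    intro x hx
    have hx' : x ∈ Metric.ball (0 : Plane) b.rIn := by
      have := hR hx
      simp only [Metric.mem_closedBall, Metric.mem_ball] at *
      have h2 : b.rIn = max R 0 + 1 := rfl
      have := le_max_left R 0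
      rw [h2]; linarith
    exact b.eventuallyEq_one_of_mem_ball hx'
  obtain ⟨D, hD⟩ := ContDiff.lipschitzWith_of_hasCompactSupport (𝕂 := ℝ) (n := 1)
    b.hasCompactSupport b.contDiff (by simp)
  have h := hw.integral_lineDeriv_mul_eq (μ := volume) hD b.hasCompactSupport v
  have h1 : ∀ x, lineDeriv ℝ w x v * b x = lineDeriv ℝ w x v := by
    intro x
    by_cases hx : x ∈ tsupport w
    · rw [(hb1 x hx).eq_of_nhds, mul_one]
    · have : w =ᶠ[𝓝 x] fun _ => 0 := notMem_tsupport_iff_eventuallyEq.1 hx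
      rw [this.lineDeriv_eq]
      simp [lineDeriv]
  have h2 : ∀ x, lineDeriv ℝ b x (-v) * w x = 0 := by
    intro x
    by_cases hx : x ∈ tsupport w
    · rw [(hb1 x hx).lineDeriv_eq]
      simp [lineDeriv]
    · rw [image_eq_zero_of_notMem_tsupport hx, mul_zero]
  simpa [h1, h2] using h

/-! ### Weak gradients -/

variable {Ω : Set Plane} {v w : Plane → ℝ} {G H : Plane → Plane}

lemma IsTest.integrable_mul {φ : Plane → ℝ} (hφ : IsTest Ω φ)
    (hv : LocallyIntegrableOn v Ω) : IntegrableOn (fun x => v x * φ x) Ω := by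
  obtain ⟨h1, h2, h3⟩ := hφ
  have h4 : IntegrableOn v (tsupport φ) := hv.integrableOn_compact_subset h3 h2
  have h5 : IntegrableOn (fun x => v x * φ x) (tsupport φ) :=
    h4.mul_continuousOn h1.continuous.continuousOn h2
  have h6 : Integrable (fun x => v x * φ x) := by
    rwa [integrableOn_iff_integrable_of_support_subset] at h5
    intro x hx
    refine subset_tsupport _ ?_
    simp only [Function.mem_support] at *
    exact right_ne_zero_of_mul hx
  exact h6.integrableOn

lemma IsTest.fderiv_apply {φ : Plane → ℝ} (hφ : IsTest Ω φ) (e : Plane) :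
    IsTest Ω (fun x => fderiv ℝ φ x e) := by
  obtain ⟨h1, h2, h3⟩ := hφ
  refine ⟨(h1.fderiv_right (m := ∞) (by simp)).clm_apply contDiff_const, ?_, ?_⟩
  · exact h2.fderiv_apply ℝ e
  · exact (tsupport_fderiv_apply_subset ℝ e).trans h3

lemma locallyIntegrableOn_apply (hG : LocallyIntegrableOn G Ω) (i : Fin 2) :
    LocallyIntegrableOn (fun x => G x i) Ω := fun x hx => by
  obtain ⟨s, hs, h⟩ := hG x hx
  exact ⟨s, hs, (EuclideanSpace.proj (𝕜 := ℝ) i : Plane →L[ℝ] ℝ).integrable_comp h⟩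

/-- The fundamental lemma of the calculus of variations, componentwise. It makes every integral of
the chosen `weakGrad` computable from any known weak gradient. -/
lemma IsWeakGrad.ae_eq (hΩ : IsOpen Ω) (hG : IsWeakGrad Ω v G) (hH : IsWeakGrad Ω v H) :
    G =ᵐ[volume.restrict Ω] H := by
  have key : ∀ i : Fin 2, ∀ᵐ x, x ∈ Ω → G x i - H x i = 0 := by
    intro i
    have hGi := locallyIntegrableOn_apply hG.2.1 i
    have hHi := locallyIntegrableOn_apply hH.2.1 i
    refine hΩ.ae_eq_zero_of_integral_contDiff_smul_eq_zero (hGi.sub hHi) ?_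
    intro φ h1 h2 h3
    have hφ : IsTest Ω φ := ⟨h1, h2, h3⟩
    have e1 := hG.2.2 φ hφ i
    have e2 := hH.2.2 φ hφ i
    have e3 : ∫ x in Ω, (G x i * φ x - H x i * φ x) = 0 := by
      rw [integral_sub (hφ.integrable_mul hGi)
        (hφ.integrable_mul hHi)]
      linarith
    rw [← e3, ← integral_indicator hΩ.measurableSet]
    refine integral_congr_ae (.of_forall fun x => ?_)
    by_cases hx : x ∈ Ω
    · simp [Set.indicator_of_mem hx]; ring
    · have : φ x = 0 := by
        by_contra h
        exact hx (h3 (subset_tsupport _ h))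
      simp [Set.indicator_of_notMem hx, this]
  rw [EventuallyEq, ae_restrict_iff' hΩ.measurableSet]
  filter_upwards [key 0, key 1] with x h0 h1 hx
  ext i
  fin_cases i
  · exact sub_eq_zero.1 (h0 hx)
  · exact sub_eq_zero.1 (h1 hx)

lemma IsWeakGrad.weakGrad_ae_eq (hΩ : IsOpen Ω) (hG : IsWeakGrad Ω v G) :
    weakGrad Ω v =ᵐ[volume.restrict Ω] G := by
  have h : ∃ G, IsWeakGrad Ω v G := ⟨G, hG⟩
  have : weakGrad Ω v = h.choose := by simp [weakGrad, h]
  rw [this]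
  exact h.choose_spec.ae_eq hΩ hG

lemma IsWeakGrad.add (hv : IsWeakGrad Ω v G) (hw : IsWeakGrad Ω w H) :
    IsWeakGrad Ω (fun x => v x + w x) (fun x => G x + H x) := by
  refine ⟨hv.1.add hw.1, hv.2.1.add hw.2.1, fun φ hφ i => ?_⟩
  have e1 := hv.2.2 φ hφ i
  have e2 := hw.2.2 φ hφ i
  have hd := hφ.fderiv_apply (EuclideanSpace.single i 1)
  simp only [add_mul, PiLp.add_apply]
  rw [integral_add (hd.integrable_mul hv.1) (hd.integrable_mul hw.1),
    integral_add (hφ.integrable_mul (locallyIntegrableOn_apply hv.2.1 i))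
      (hφ.integrable_mul (locallyIntegrableOn_apply hw.2.1 i)), e1, e2]
  ring

lemma IsWeakGrad.const_mul (hv : IsWeakGrad Ω v G) (c : ℝ) :
    IsWeakGrad Ω (fun x => c * v x) (fun x => c • G x) := by
  refine ⟨fun x hx => ?_, fun x hx => ?_, fun φ hφ i => ?_⟩
  · exact (hv.1 x hx).smul c
  · exact (hv.2.1 x hx).smul c
  · simp only [PiLp.smul_apply, smul_eq_mul, mul_assoc, integral_const_mul, hv.2.2 φ hφ i]
    ring

lemma IsWeakGrad.sub (hv : IsWeakGrad Ω v G) (hw : IsWeakGrad Ω w H) :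
    IsWeakGrad Ω (fun x => v x - w x) (fun x => G x - H x) := by
  simpa [sub_eq_add_neg] using hv.add (hw.const_mul (-1))

lemma IsWeakGrad.congr_left (hΩ : IsOpen Ω) (hv : IsWeakGrad Ω v G) (h : Set.EqOn v w Ω) :
    IsWeakGrad Ω w G := by
  refine ⟨fun x hx => ?_, hv.2.1, fun φ hφ i => ?_⟩
  · obtain ⟨s, hs, hi⟩ := hv.1 x hx
    refine ⟨s ∩ Ω, inter_mem hs self_mem_nhdsWithin, ?_⟩
    refine ((hi.mono_set Set.inter_subset_left).congr_fun_ae ?_)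
    have : ∀ᵐ x ∂(volume.restrict (s ∩ Ω)), x ∈ Ω :=
      ae_mono (Measure.restrict_mono Set.inter_subset_right le_rfl)
        (ae_restrict_mem hΩ.measurableSet)
    filter_upwards [this] with x hx using h hx
  · rw [← hv.2.2 φ hφ i]
    refine setIntegral_congr_fun hΩ.measurableSet fun x hx => ?_
    simp [h hx]

lemma IsWeakGrad.mono {D : Set Plane} (hΩ : IsOpen Ω) (hDΩ : D ⊆ Ω)
    (hv : IsWeakGrad Ω v G) : IsWeakGrad D v G := by
  refine ⟨hv.1.mono_set hDΩ, hv.2.1.mono_set hDΩ, fun φ hφ i => ?_⟩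
  have hφ' : IsTest Ω φ := ⟨hφ.1, hφ.2.1, hφ.2.2.trans hDΩ⟩
  have hd := hφ.fderiv_apply (EuclideanSpace.single i 1)
  have e := hv.2.2 φ hφ' i
  rw [setIntegral_eq_of_subset_of_forall_sdiff_eq_zero hΩ.measurableSet hDΩ,
    setIntegral_eq_of_subset_of_forall_sdiff_eq_zero hΩ.measurableSet hDΩ] at e
  · exact e
  · rintro x ⟨-, hx⟩
    rw [image_eq_zero_of_notMem_tsupport (f := φ) fun h => hx (hφ.2.2 h), mul_zero]
  · rintro x ⟨-, hx⟩
    have := image_eq_zero_of_notMem_tsupport (f := fun x => fderiv ℝ φ x (EuclideanSpace.single i 1))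
      fun h => hx (hd.2.2 h)
    rw [this, mul_zero]

/-! ### Functions with bounded weak gradient -/

lemma locallyIntegrableOn_inner (hG : LocallyIntegrableOn G Ω) (e : Plane) :
    LocallyIntegrableOn (fun x => inner ℝ (G x) e) Ω := fun x hx => by
  obtain ⟨s, hs, h⟩ := hG x hx
  refine ⟨s, hs, ?_⟩
  have h' : Integrable (fun a => inner ℝ e (G a)) (volume.restrict s) := (innerSL ℝ e).integrable_comp h
  simp only [real_inner_comm e]
  exact h'

lemma IsWeakGrad.integral_fderiv_apply (hv : IsWeakGrad Ω v G)
    {φ : Plane → ℝ} (hφ : IsTest Ω φ) (e : Plane) :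
    ∫ x in Ω, v x * fderiv ℝ φ x e = - ∫ x in Ω, inner ℝ (G x) e * φ x := by
  have he : e = e 0 • EuclideanSpace.single 0 1 + e 1 • EuclideanSpace.single 1 1 := by
    ext i; fin_cases i <;> simp
  have h1 : ∀ x, v x * fderiv ℝ φ x e = e 0 * (v x * fderiv ℝ φ x (EuclideanSpace.single 0 1)) +
      e 1 * (v x * fderiv ℝ φ x (EuclideanSpace.single 1 1)) := fun x => by
    conv_lhs => rw [he]
    simp only [map_add, map_smul, smul_eq_mul]
    ring
  have h2 : ∀ x, inner ℝ (G x) e * φ x = e 0 * (G x 0 * φ x) + e 1 * (G x 1 * φ x) := fun x => by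
    simp [PiLp.inner_apply, Fin.sum_univ_two]
    ring
  simp only [h1, h2]
  rw [integral_add, integral_add]
  · simp only [integral_const_mul, hv.2.2 φ hφ]
    ring
  · exact (hφ.integrable_mul (locallyIntegrableOn_apply hv.2.1 0)).const_mul _
  · exact (hφ.integrable_mul (locallyIntegrableOn_apply hv.2.1 1)).const_mul _
  · exact ((hφ.fderiv_apply _).integrable_mul hv.1).const_mul _
  · exact ((hφ.fderiv_apply _).integrable_mul hv.1).const_mul _

/-- The derivative of the mollified function at `z` is an average of `H` against a nonnegative
kernel of mass 1 living in `D`, so it inherits the a.e. bound on `H - q`. -/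
lemma norm_fderiv_mollify_sub_le {D : Set Plane} (hD : IsOpen D) (hvi : IntegrableOn v D)
    (hv : IsWeakGrad D v H) {q : Plane} {M : ℝ}
    (hM : ∀ᵐ x ∂(volume.restrict D), ‖H x - q‖ ≤ M) (ρ : ContDiffBump (0 : Plane)) {z : Plane}
    (hz : Metric.closedBall z ρ.rOut ⊆ D) :
    DifferentiableAt ℝ
      (convolution (ρ.normed volume) (D.indicator v) (ContinuousLinearMap.lsmul ℝ ℝ) volume) z ∧
    ‖fderiv ℝ (convolution (ρ.normed volume) (D.indicator v) (ContinuousLinearMap.lsmul ℝ ℝ) volume) z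
      - innerSL ℝ q‖ ≤ M := by
  set r := ρ.normed (volume : Measure Plane) with hr
  have hrc : HasCompactSupport r := ρ.hasCompactSupport_normed
  have hrd : ContDiff ℝ ∞ r := ρ.contDiff_normed (n := ⊤)
  have hvl : LocallyIntegrable (D.indicator v) :=
    ((integrable_indicator_iff hD.measurableSet).2 hvi).locallyIntegrable
  have hfd := hrc.hasFDerivAt_convolution_left (ContinuousLinearMap.lsmul ℝ ℝ)
    (hrd.of_le (by simp)) hvl z
  refine ⟨hfd.differentiableAt, ?_⟩
  have hM0 : 0 ≤ M := by
    have hne : (ae (volume.restrict D)).NeBot := by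
      rw [ae_neBot, Ne, Measure.restrict_eq_zero]
      exact (hD.measure_pos volume ⟨z, hz (by simp [ρ.rOut_pos.le])⟩).ne'
    obtain ⟨x, hx⟩ := hM.exists
    exact (norm_nonneg _).trans hx
  -- The reflected kernel is an admissible test function because its support, a closed ball about
  -- `z`, lies in `D`.
  have hψ : IsTest D (fun t => r (z - t)) := by
    refine ⟨by fun_prop, ?_, ?_⟩
    · exact hrc.comp_homeomorph (Homeomorph.subLeft z)
    · refine (closure_minimal ?_ Metric.isClosed_closedBall).trans hz
      intro t ht
      have : z - t ∈ Function.support r := ht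
      rw [hr, ρ.support_normed_eq] at this
      simp only [Metric.mem_ball, dist_zero_right, Metric.mem_closedBall] at *
      rw [dist_comm, dist_eq_norm]
      exact this.le
  have hone : ∫ t in D, r (z - t) = 1 := by
    rw [setIntegral_eq_integral_of_forall_compl_eq_zero, integral_sub_left_eq_self r volume z,
      ρ.integral_normed]
    intro x hx
    exact image_eq_zero_of_notMem_tsupport (f := fun t => r (z - t)) fun h => hx (hψ.2.2 h)
  refine ContinuousLinearMap.opNorm_le_bound _ hM0 fun e => ?_
  rw [hfd.fderiv]
  have hval : (convolution (fderiv ℝ r) (D.indicator v)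
      ((ContinuousLinearMap.lsmul ℝ ℝ).precompL Plane) volume z) e
      = ∫ t in D, inner ℝ (H t) e * r (z - t) := by
    have hex : ConvolutionExistsAt (fderiv ℝ r) (D.indicator v) z
      ((ContinuousLinearMap.lsmul ℝ ℝ).precompL Plane) volume :=
      (hrc.fderiv ℝ).convolutionExists_left _ (hrd.continuous_fderiv (by simp)) hvl z
    have hex' := hex.integrable_swap
    rw [convolution_eq_swap, ContinuousLinearMap.integral_apply hex', ]
    have h1 := hv.integral_fderiv_apply hψ e
    rw [← neg_eq_iff_eq_neg] at h1
    rw [← h1, ← integral_neg, ← integral_indicator hD.measurableSet]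
    refine integral_congr_ae (.of_forall fun t => ?_)
    have h2 : fderiv ℝ (fun t => r (z - t)) t e = - fderiv ℝ r (z - t) e := by
      have := ((hrd.differentiable (by simp) (z - t)).hasFDerivAt.comp t
        ((hasFDerivAt_id t).const_sub z)).fderiv
      change fderiv ℝ (r ∘ HSub.hSub z) t e = _
      rw [this]; simp
    by_cases ht : t ∈ D
    · simp only [Set.indicator_of_mem ht, h2]
      simp [ContinuousLinearMap.precompL_apply]
      ring
    · simp [Set.indicator_of_notMem ht]
  have hi1 : IntegrableOn (fun t => inner ℝ (H t) e * r (z - t)) D :=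
    hψ.integrable_mul (locallyIntegrableOn_inner hv.2.1 e)
  have hi2 : IntegrableOn (fun t => r (z - t)) D :=
    (hψ.1.continuous.integrable_of_hasCompactSupport hψ.2.1).integrableOn
  rw [sub_apply, hval, innerSL_apply_apply]
  have h3 : (inner ℝ q e : ℝ) = ∫ t in D, inner ℝ q e * r (z - t) := by
    rw [integral_const_mul, hone, mul_one]
  rw [h3, ← integral_sub hi1 (hi2.const_mul _)]
  calc _ ≤ ∫ t in D, (M * ‖e‖) * r (z - t) := by
        refine norm_integral_le_of_norm_le (hi2.const_mul _) ?_
        filter_upwards [hM] with t ht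
        rw [← sub_mul, ← inner_sub_left, norm_mul, Real.norm_of_nonneg (ρ.nonneg_normed _)]
        refine mul_le_mul_of_nonneg_right ?_ (ρ.nonneg_normed _)
        exact (norm_inner_le_norm _ _).trans (mul_le_mul_of_nonneg_right ht (norm_nonneg _))
    _ = M * ‖e‖ := by rw [integral_const_mul, hone, mul_one]

/-- A function on a convex open set whose weak gradient is within `M` of the constant `q` differs
from the linear function `⟪q, ·⟫` by an `M`-Lipschitz function, up to a null set. -/
lemma exists_null_abs_sub_sub_inner_le {D : Set Plane} (hD : IsOpen D) (hconv : Convex ℝ D)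
    (hvi : IntegrableOn v D) (hv : IsWeakGrad D v H) {q : Plane} {M : ℝ}
    (hM : ∀ᵐ x ∂(volume.restrict D), ‖H x - q‖ ≤ M) :
    ∃ N : Set Plane, volume N = 0 ∧ ∀ x ∈ D \ N, ∀ y ∈ D \ N,
      |v x - v y - inner ℝ q (x - y)| ≤ M * dist x y := by
  -- The fixed ratio 2 of outer to inner radius is what a.e. convergence of the mollifications
  -- requires.
  let ρ : ℕ → ContDiffBump (0 : Plane) := fun n =>
    ⟨1 / ((n : ℝ) + 1), 2 * (1 / ((n : ℝ) + 1)), by positivity, by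
      have : 0 < 1 / ((n : ℝ) + 1) := by positivity
      linarith⟩
  have hρ : Tendsto (fun n => (ρ n).rOut) atTop (𝓝 0) := by
    have := (tendsto_one_div_add_atTop_nhds_zero_nat (𝕜 := ℝ)).const_mul 2
    rwa [mul_zero] at this
  have hvl : LocallyIntegrable (D.indicator v) :=
    ((integrable_indicator_iff hD.measurableSet).2 hvi).locallyIntegrable
  have hae := ContDiffBump.ae_convolution_tendsto_right_of_locallyIntegrable (μ := volume)
    (φ := ρ) (l := atTop) (K := 2) hρ (.of_forall fun n => le_rfl) hvl
  refine ⟨_, hae, ?_⟩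
  rintro x ⟨hx, hxN⟩ y ⟨hy, hyN⟩
  simp only [Set.mem_compl_iff, Set.mem_ofPred_eq, not_not] at hxN hyN
  rw [Set.indicator_of_mem hx] at hxN
  rw [Set.indicator_of_mem hy] at hyN
  have hseg : segment ℝ x y ⊆ D := hconv.segment_subset hx hy
  -- Compactness gives one radius for which the kernels centred on the segment all stay in `D`; the
  -- mean value inequality then applies along it.
  have hcomp : IsCompact (segment ℝ x y) := by
    rw [segment_eq_image]
    exact isCompact_Icc.image (by fun_prop)
  obtain ⟨δ, hδ, hδD⟩ := hcomp.exists_cthickening_subset_open hD hseg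
  have hlim := ((hxN.sub hyN).sub_const (inner ℝ q (x - y))).abs
  refine le_of_tendsto hlim ?_
  filter_upwards [hρ.eventually (gt_mem_nhds hδ)] with n hn
  have hball : ∀ z ∈ segment ℝ x y, Metric.closedBall z (ρ n).rOut ⊆ D := fun z hz =>
    (Metric.closedBall_subset_closedBall hn.le).trans
      ((Metric.closedBall_subset_cthickening hz δ).trans hδD)
  have := (convex_segment x y).norm_image_sub_le_of_norm_fderiv_le' (𝕜 := ℝ)
    (fun z hz => (norm_fderiv_mollify_sub_le hD hvi hv hM (ρ n) (hball z hz)).1)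
    (fun z hz => (norm_fderiv_mollify_sub_le hD hvi hv hM (ρ n) (hball z hz)).2)
    (right_mem_segment ℝ x y) (left_mem_segment ℝ x y)
  rw [dist_eq_norm]
  simpa using this

/-- On a bounded convex open subset, a `W^{2,∞}` function is, up to a Lipschitz error
proportional to the diameter, linear. -/
lemma exists_gradient_approx (hΩ : IsOpen Ω) {D : Set Plane} (hD : IsOpen D) (hconv : Convex ℝ D)
    (hDΩ : D ⊆ Ω) (hDne : D.Nonempty) (hDb : Bornology.IsBounded D)
    {u : Plane → ℝ} (hu : IntegrableOn u Ω) (hG : IsWeakGrad Ω u G) (hGi : IntegrableOn G Ω)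
    {H : Fin 2 → Plane → Plane} (hH : ∀ i, IsWeakGrad Ω (fun x => G x i) (H i)) {M : ℝ}
    (hM : ∀ i, ∀ᵐ x ∂(volume.restrict Ω), ‖H i x‖ ≤ M) (huc : ContinuousOn u (closure D)) :
    ∃ q : Plane, (∀ᵐ x ∂(volume.restrict D), ‖G x - q‖ ≤ 2 * M * Metric.diam D) ∧
      ∀ x ∈ closure D, ∀ y ∈ closure D,
        |u x - u y - inner ℝ q (x - y)| ≤ 2 * M * Metric.diam D * dist x y := by
  have hGii : ∀ i, IntegrableOn (fun x => G x i) D := fun i =>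
    (EuclideanSpace.proj (𝕜 := ℝ) i : Plane →L[ℝ] ℝ).integrable_comp (hGi.mono_set hDΩ)
  have hMD : ∀ i, ∀ᵐ x ∂(volume.restrict D), ‖H i x - 0‖ ≤ M := fun i => by
    filter_upwards [ae_mono (Measure.restrict_mono hDΩ le_rfl) (hM i)] with x hx
    simpa using hx
  choose N hN0 hN using fun i => exists_null_abs_sub_sub_inner_le hD hconv (hGii i)
    ((hH i).mono hΩ hDΩ) (hMD i)
  have hNN : volume (N 0 ∪ N 1) = 0 := measure_union_null (hN0 0) (hN0 1)
  have hdense : ∀ N : Set Plane, volume N = 0 → D ⊆ closure (D \ N) := by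
    intro N hN x hx
    rw [Metric.mem_closure_iff]
    intro ε hε
    by_contra! hcon
    have hsub : D ∩ Metric.ball x ε ⊆ N := fun y hy => by
      by_contra hyN
      exact absurd (hcon y ⟨hy.1, hyN⟩) (not_le.2 (by rw [dist_comm]; exact hy.2))
    exact ((hD.inter Metric.isOpen_ball).measure_pos volume
      ⟨x, hx, Metric.mem_ball_self hε⟩).ne' (measure_mono_null hsub hN)
  -- Both components of `G` are `M`-Lipschitz off a null set, so the value of `G` at any point off
  -- that set serves as `q`.
  obtain ⟨x₀, hx₀⟩ : (D \ (N 0 ∪ N 1)).Nonempty := by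
    obtain ⟨x, hx⟩ := hDne
    exact closure_nonempty_iff.1 ⟨x, hdense _ hNN hx⟩
  have hGq : ∀ᵐ x ∂(volume.restrict D), ‖G x - G x₀‖ ≤ 2 * M * Metric.diam D := by
    rw [ae_restrict_iff' hD.measurableSet]
    have : ∀ᵐ x, x ∉ N 0 ∪ N 1 := measure_eq_zero_iff_ae_notMem.1 hNN
    filter_upwards [this] with x hxN hxD
    have h0 := hN 0 x ⟨hxD, fun h => hxN (Or.inl h)⟩ x₀ ⟨hx₀.1, fun h => hx₀.2 (Or.inl h)⟩
    have h1 := hN 1 x ⟨hxD, fun h => hxN (Or.inr h)⟩ x₀ ⟨hx₀.1, fun h => hx₀.2 (Or.inr h)⟩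
    simp only [inner_zero_left, sub_zero] at h0 h1
    have hM0 : 0 ≤ M ∨ dist x x₀ = 0 := by
      by_contra! hcon
      have hpos : 0 < dist x x₀ := lt_of_le_of_ne dist_nonneg (Ne.symm hcon.2)
      nlinarith [abs_nonneg (G x 0 - G x₀ 0)]
    have hd : M * dist x x₀ ≤ M * Metric.diam D := by
      rcases hM0 with hM0 | hM0
      · exact mul_le_mul_of_nonneg_left (Metric.dist_le_diam_of_mem hDb hxD hx₀.1) hM0
      · have hMM : 0 ≤ M := by
          have hne : (ae (volume.restrict D)).NeBot := by
            rw [ae_neBot, Ne, Measure.restrict_eq_zero]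
            exact (hD.measure_pos volume hDne).ne'
          obtain ⟨x, hx⟩ := (hMD 0).exists
          exact (norm_nonneg _).trans hx
        rw [hM0, mul_zero]
        exact mul_nonneg hMM Metric.diam_nonneg
    rw [EuclideanSpace.norm_eq, Fin.sum_univ_two]
    have hMM : 0 ≤ M * Metric.diam D := (abs_nonneg _).trans (h0.trans hd)
    refine Real.sqrt_le_iff.2 ⟨by linarith, ?_⟩
    simp only [PiLp.sub_apply, Real.norm_eq_abs]
    -- Two components give a factor `√2`, rounded up to 2.
    nlinarith [pow_le_pow_left₀ (abs_nonneg _) (h0.trans hd) 2,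
      pow_le_pow_left₀ (abs_nonneg _) (h1.trans hd) 2]
  refine ⟨G x₀, hGq, ?_⟩
  obtain ⟨N', hN'0, hN'⟩ := exists_null_abs_sub_sub_inner_le hD hconv (hu.mono_set hDΩ)
    (hG.mono hΩ hDΩ) hGq
  have hcl : closure D = closure (D \ N') :=
    subset_antisymm (closure_minimal (hdense _ hN'0) isClosed_closure)
      (closure_mono Set.sdiff_subset)
  -- Both sides are continuous in the pair of points, so the estimate extends from a dense subset to
  -- the closure.
  have hprod : ∀ p ∈ closure ((D \ N') ×ˢ (D \ N')),
      |u p.1 - u p.2 - inner ℝ (G x₀) (p.1 - p.2)| ≤ 2 * M * Metric.diam D * dist p.1 p.2 := by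
    intro p hp
    refine le_on_closure (s := (D \ N') ×ˢ (D \ N'))
      (f := fun p : Plane × Plane => |u p.1 - u p.2 - inner ℝ (G x₀) (p.1 - p.2)|)
      (g := fun p : Plane × Plane => 2 * M * Metric.diam D * dist p.1 p.2)
      (fun p hp => hN' p.1 hp.1 p.2 hp.2) ?_ (by fun_prop) hp
    rw [closure_prod_eq, ← hcl]
    have c1 : ContinuousOn (fun p : Plane × Plane => u p.1) (closure D ×ˢ closure D) :=
      huc.comp continuousOn_fst fun p hp => hp.1
    have c2 : ContinuousOn (fun p : Plane × Plane => u p.2) (closure D ×ˢ closure D) :=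
      huc.comp continuousOn_snd fun p hp => hp.2
    exact ((c1.sub c2).sub (by fun_prop)).abs
  intro x hx y hy
  refine hprod (x, y) ?_
  rw [closure_prod_eq, ← hcl]
  exact ⟨hx, hy⟩

/-! ### Affine functions and triangles -/

/-- The (constant) gradient of an affine function. -/
noncomputable def affineGrad (l : Plane →ᵃ[ℝ] ℝ) : Plane :=
  (InnerProductSpace.toDual ℝ Plane).symm (LinearMap.toContinuousLinearMap l.linear)

lemma inner_affineGrad (l : Plane →ᵃ[ℝ] ℝ) (x y : Plane) :
    inner ℝ (affineGrad l) (x - y) = l x - l y := by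
  have : l x - l y = l.linear (x - y) := by
    have := l.linearMap_vsub x y
    simpa using this.symm
  rw [this, affineGrad, InnerProductSpace.toDual_symm_apply]
  rfl

lemma affine_eq_inner_add (l : Plane →ᵃ[ℝ] ℝ) (x : Plane) :
    l x = inner ℝ (affineGrad l) x + l 0 := by
  have := inner_affineGrad l x 0
  rw [sub_zero] at this
  linarith

lemma continuous_affine (l : Plane →ᵃ[ℝ] ℝ) : Continuous l := by
  have : ⇑l = fun x => inner ℝ (affineGrad l) x + l 0 := funext (affine_eq_inner_add l)
  rw [this]; fun_prop

lemma contDiff_affine (l : Plane →ᵃ[ℝ] ℝ) {n : WithTop ℕ∞} : ContDiff ℝ n l := by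
  have : ⇑l = fun x => innerSL ℝ (affineGrad l) x + l 0 := funext (affine_eq_inner_add l)
  rw [this]; fun_prop

lemma hasGradientAt_affine (l : Plane →ᵃ[ℝ] ℝ) (x : Plane) :
    HasGradientAt l (affineGrad l) x := by
  have : ⇑l = fun x => innerSL ℝ (affineGrad l) x + l 0 := funext (affine_eq_inner_add l)
  rw [hasGradientAt_iff_hasFDerivAt, this]
  exact ((innerSL ℝ (affineGrad l)).hasFDerivAt).add_const _

lemma eqOn_convexHull_of_eqOn {l l' : Plane →ᵃ[ℝ] ℝ} {s : Set Plane} (h : Set.EqOn l l' s) :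
    Set.EqOn l l' (convexHull ℝ s) := by
  have hc : Convex ℝ {x | l x = l' x} := by
    intro x hx y hy a b ha hb hab
    have h1 := Convex.combo_affine_apply (f := l) (x := x) (y := y) hab
    have h2 := Convex.combo_affine_apply (f := l') (x := x) (y := y) hab
    change l x = l' x at hx
    change l y = l' y at hy
    change l _ = l' _
    rw [h1, h2, hx, hy]
  exact convexHull_min h hc

namespace Triangle

variable (K : Triangle)

lemma verts_eq_range : K.verts = Set.range ![K.A, K.B, K.C] := by
  ext x
  simp only [verts, Set.mem_insert_iff, Set.mem_singleton_iff, Set.mem_range, Fin.exists_fin_succ,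
    Matrix.cons_val_zero, Matrix.cons_val_succ]
  simp [eq_comm]

lemma finite_verts : K.verts.Finite := by simp [verts]

lemma affineSpan_verts : affineSpan ℝ K.verts = ⊤ := by
  rw [verts_eq_range, K.indep.affineSpan_eq_top_iff_card_eq_finrank_add_one]
  simp

lemma isCompact_carrier : IsCompact K.carrier := K.finite_verts.isCompact_convexHull (𝕜 := ℝ)

lemma isClosed_carrier : IsClosed K.carrier := K.isCompact_carrier.isClosed

lemma convex_carrier : Convex ℝ K.carrier := convex_convexHull ℝ _

lemma verts_subset_carrier : K.verts ⊆ K.carrier := subset_convexHull ℝ _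

lemma A_mem_verts : K.A ∈ K.verts := by simp [verts]

lemma B_mem_verts : K.B ∈ K.verts := by simp [verts]

lemma C_mem_verts : K.C ∈ K.verts := by simp [verts]

lemma interior_nonempty : (interior K.carrier).Nonempty :=
  interior_convexHull_nonempty_iff_affineSpan_eq_top.2 K.affineSpan_verts

lemma closure_interior : closure (interior K.carrier) = K.carrier := by
  rw [K.convex_carrier.closure_interior_eq_closure_of_nonempty_interior K.interior_nonempty,
    K.isClosed_carrier.closure_eq]

lemma diam_interior : Metric.diam (interior K.carrier) = K.diam := by
  rw [← Metric.diam_closure, closure_interior, diam]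

lemma ae_mem_interior : ∀ᵐ x, x ∈ K.carrier → x ∈ interior K.carrier := by
  have h := measure_eq_zero_iff_ae_notMem.1 (K.convex_carrier.addHaar_frontier volume)
  filter_upwards [h] with x hx hxK
  by_contra hcon
  exact hx ⟨subset_closure hxK, hcon⟩

lemma dist_le_diam {x y : Plane} (hx : x ∈ K.carrier) (hy : y ∈ K.carrier) :
    dist x y ≤ K.diam :=
  Metric.dist_le_diam_of_mem K.isCompact_carrier.isBounded hx hy

lemma diam_nonneg : 0 ≤ K.diam := Metric.diam_nonneg

lemma A_ne_B : K.A ≠ K.B := fun h => by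
  have := K.indep.injective.ne (show (0 : Fin 3) ≠ 1 by decide)
  exact this h

lemma A_ne_C : K.A ≠ K.C := fun h => by
  have := K.indep.injective.ne (show (0 : Fin 3) ≠ 2 by decide)
  exact this h

lemma B_ne_C : K.B ≠ K.C := fun h => by
  have := K.indep.injective.ne (show (1 : Fin 3) ≠ 2 by decide)
  exact this h

lemma radius_pos : 0 < K.radius := by
  have h1 : 0 < dist K.A K.B := dist_pos.2 K.A_ne_B
  have h2 : 0 < dist K.A K.C := dist_pos.2 K.A_ne_C
  unfold radius
  have := lt_min h1 h2
  linarith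

lemma radius_le_diam : K.radius ≤ K.diam / 2 := by
  have h1 := K.dist_le_diam (K.verts_subset_carrier K.A_mem_verts)
    (K.verts_subset_carrier K.B_mem_verts)
  have := min_le_left (dist K.A K.B) (dist K.A K.C)
  unfold radius
  linarith

/-- Affine interpolation at the vertices. -/
lemma exists_affine (f : Plane → ℝ) : ∃ l : Plane →ᵃ[ℝ] ℝ, Set.EqOn l f K.verts := by
  have htop : affineSpan ℝ (Set.range ![K.A, K.B, K.C]) = ⊤ := by
    rw [← verts_eq_range, affineSpan_verts]
  let b : AffineBasis (Fin 3) ℝ Plane := ⟨![K.A, K.B, K.C], K.indep, htop⟩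
  have hb : ∀ i, b i = ![K.A, K.B, K.C] i := fun i => rfl
  refine ⟨∑ i, f (b i) • b.coord i, ?_⟩
  rw [verts_eq_range]
  rintro _ ⟨j, rfl⟩
  rw [← hb j]
  have : ∀ (s : Finset (Fin 3)) (x : Plane),
      (∑ i ∈ s, f (b i) • b.coord i : Plane →ᵃ[ℝ] ℝ) x = ∑ i ∈ s, f (b i) * b.coord i x := by
    intro s x
    induction s using Finset.induction_on with
    | empty => simp
    | insert a s ha ih => rw [Finset.sum_insert ha, Finset.sum_insert ha, ← ih]; simp
  rw [this]
  simp [AffineBasis.coord_apply]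

end Triangle

/-! ### Triangulations and continuous piecewise affine functions. -/

namespace Triangulation

variable (T : Triangulation Ω)

lemma carrier_subset {K : Triangle} (hK : K ∈ T.elements) : K.carrier ⊆ closure Ω := by
  rw [← T.cover]
  exact Set.subset_biUnion_of_mem (u := fun K : Triangle => K.carrier) hK

lemma exists_mem_carrier {x : Plane} (hx : x ∈ closure Ω) : ∃ K ∈ T.elements, x ∈ K.carrier := by
  rw [← T.cover] at hx
  simpa using hx

/-- The regularity of `Ω` excludes slits, across which an element could otherwise extend. -/
lemma interior_carrier_subset (hreg : interior (closure Ω) = Ω) {K : Triangle}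
    (hK : K ∈ T.elements) : interior K.carrier ⊆ Ω := by
  rw [← hreg]
  exact interior_mono (T.carrier_subset hK)

lemma ae_exists_mem_interior (hΩ : IsOpen Ω) :
    ∀ᵐ x ∂(volume.restrict Ω), ∃ K ∈ T.elements, x ∈ interior K.carrier := by
  rw [ae_restrict_iff' hΩ.measurableSet]
  have : ∀ᵐ x, ∀ K ∈ T.elements, x ∈ K.carrier → x ∈ interior K.carrier :=
    (T.elements.eventually_all).2 fun K _ => K.ae_mem_interior
  filter_upwards [this] with x hx hxΩ
  obtain ⟨K, hK, hxK⟩ := T.exists_mem_carrier (subset_closure hxΩ)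
  exact ⟨K, hK, hx K hK hxK⟩

lemma diam_le_meshSize {K : Triangle} (hK : K ∈ T.elements) : K.diam ≤ T.meshSize :=
  le_csSup (T.elements.finite_toSet.image _).bddAbove ⟨K, hK, rfl⟩

/-- Lagrange interpolation: there is a function in `X_h` with prescribed values at the vertices. -/
lemma exists_memX (f : Plane → ℝ) :
    ∃ v, T.MemX v ∧ ∀ K ∈ T.elements, ∀ P ∈ K.verts, v P = f P := by
  classical
  choose l hl using fun K : Triangle => K.exists_affine f
  let v : Plane → ℝ := fun x =>
    if h : ∃ K ∈ T.elements, x ∈ K.carrier then l h.choose x else 0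
  have hv : ∀ K ∈ T.elements, Set.EqOn v (l K) K.carrier := by
    intro K hK x hx
    have h : ∃ K ∈ T.elements, x ∈ K.carrier := ⟨K, hK, hx⟩
    have hvx : v x = l h.choose x := by simp only [v, dif_pos h]
    rw [hvx]
    obtain ⟨hK', hx'⟩ := h.choose_spec
    -- The choice of element is immaterial: by conformity two elements meet in the hull of their
    -- common vertices, where their interpolants agree.
    by_cases hKK : h.choose = K
    · rw [hKK]
    · have hmem : x ∈ convexHull ℝ (h.choose.verts ∩ K.verts) := by
        rw [← T.conforming _ hK' _ hK hKK]
        exact ⟨hx', hx⟩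
      refine eqOn_convexHull_of_eqOn (l := l h.choose) (l' := l K) ?_ hmem
      rintro P ⟨hP, hP'⟩
      rw [hl _ hP, hl _ hP']
  refine ⟨v, ⟨?_, fun K hK => ⟨l K, hv K hK⟩⟩, fun K hK P hP => ?_⟩
  · rw [← T.cover]
    have hb : ⋃ K ∈ T.elements, K.carrier = ⋃ K : T.elements, K.1.carrier := by
      ext x; simp
    rw [hb]
    refine (locallyFinite_of_finite _).continuousOn_iUnion (fun K => K.1.isClosed_carrier) ?_
    exact fun K => (continuous_affine (l K.1)).continuousOn.congr (hv K.1 K.2)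
  · rw [hv K hK (K.verts_subset_carrier hP), hl K hP]

variable {T}

lemma MemX.add (hv : T.MemX v) (hw : T.MemX w) : T.MemX (fun x => v x + w x) := by
  refine ⟨hv.1.add hw.1, fun K hK => ?_⟩
  obtain ⟨l, hl⟩ := hv.2 K hK
  obtain ⟨m, hm⟩ := hw.2 K hK
  exact ⟨l + m, fun x hx => by simp [hl hx, hm hx]⟩

lemma MemX.const_mul (hv : T.MemX v) (c : ℝ) : T.MemX (fun x => c * v x) := by
  refine ⟨continuousOn_const.mul hv.1, fun K hK => ?_⟩
  obtain ⟨l, hl⟩ := hv.2 K hK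
  exact ⟨c • l, fun x hx => by simp [hl hx]⟩

lemma MemX.sub (hv : T.MemX v) (hw : T.MemX w) : T.MemX (fun x => v x - w x) := by
  simpa [sub_eq_add_neg] using hv.add (hw.const_mul (-1))

lemma MemX.congr (hv : T.MemX v) (h : Set.EqOn w v (closure Ω)) : T.MemX w := by
  refine ⟨hv.1.congr h, fun K hK => ?_⟩
  obtain ⟨l, hl⟩ := hv.2 K hK
  exact ⟨l, fun x hx => (h (T.carrier_subset hK hx)).trans (hl hx)⟩

lemma hasGradientAt_of_eqOn {K : Triangle} {l : Plane →ᵃ[ℝ] ℝ} (hl : Set.EqOn v l K.carrier)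
    {x : Plane} (hx : x ∈ interior K.carrier) : HasGradientAt v (affineGrad l) x :=
  (hasGradientAt_affine l x).congr_of_eventuallyEq
    (Filter.eventuallyEq_of_mem (mem_interior_iff_mem_nhds.1 hx) hl)

lemma MemX.ae_differentiableAt (hΩ : IsOpen Ω) (hv : T.MemX v) :
    ∀ᵐ x ∂(volume.restrict Ω), DifferentiableAt ℝ v x := by
  filter_upwards [T.ae_exists_mem_interior hΩ] with x ⟨K, hK, hx⟩
  obtain ⟨l, hl⟩ := hv.2 K hK
  exact (hasGradientAt_of_eqOn hl hx).differentiableAt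

lemma MemX.exists_norm_affineGrad_le (hv : T.MemX v) :
    ∃ C : NNReal, ∀ K ∈ T.elements, ∃ l : Plane →ᵃ[ℝ] ℝ,
      Set.EqOn v l K.carrier ∧ ‖affineGrad l‖ ≤ C := by
  classical
  choose! l hl using hv.2
  refine ⟨T.elements.sup fun K => ‖affineGrad (l K)‖₊, fun K hK => ⟨l K, hl K hK, ?_⟩⟩
  exact_mod_cast Finset.le_sup (f := fun K => ‖affineGrad (l K)‖₊) hK

lemma MemX.exists_norm_gradient_le (hΩ : IsOpen Ω) (hv : T.MemX v) :
    ∃ C : ℝ, ∀ᵐ x ∂(volume.restrict Ω), ‖gradient v x‖ ≤ C := by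
  obtain ⟨C, hC⟩ := hv.exists_norm_affineGrad_le
  refine ⟨C, ?_⟩
  filter_upwards [T.ae_exists_mem_interior hΩ] with x ⟨K, hK, hx⟩
  obtain ⟨l, hl, hlC⟩ := hC K hK
  rwa [(hasGradientAt_of_eqOn hl hx).gradient]

end Triangulation

lemma measurable_gradient (v : Plane → ℝ) : Measurable (gradient v) :=
  ((InnerProductSpace.toDual ℝ Plane).symm.continuous.measurable).comp (measurable_fderiv ℝ v)

lemma gradient_apply (v : Plane → ℝ) (x : Plane) (i : Fin 2) :
    gradient v x i = fderiv ℝ v x (EuclideanSpace.single i 1) := by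
  rw [← inner_gradient_left, EuclideanSpace.inner_single_right]
  simp

namespace Triangulation

variable {T : Triangulation Ω}

lemma MemX.memLp_gradient (hΩ : IsOpen Ω) (hb : Bornology.IsBounded Ω) (hv : T.MemX v)
    (p : ℝ≥0∞) : MemLp (gradient v) p (volume.restrict Ω) := by
  have : IsFiniteMeasure (volume.restrict Ω) := ⟨by simpa using hb.measure_lt_top⟩
  obtain ⟨C, hC⟩ := hv.exists_norm_gradient_le hΩ
  exact MemLp.of_bound (measurable_gradient v).aestronglyMeasurable C hC

lemma MemX.memLp (hΩ : IsOpen Ω) (hb : Bornology.IsBounded Ω) (hv : T.MemX v) (p : ℝ≥0∞) :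
    MemLp v p (volume.restrict Ω) := by
  have : IsFiniteMeasure (volume.restrict Ω) := ⟨by simpa using hb.measure_lt_top⟩
  obtain ⟨C, hC⟩ := hb.isCompact_closure.exists_bound_of_continuousOn hv.1
  refine MemLp.of_bound ((hv.1.mono subset_closure).aestronglyMeasurable hΩ.measurableSet) C ?_
  filter_upwards [ae_restrict_mem hΩ.measurableSet] with x hx using hC x (subset_closure hx)

/-- A finite element function is weakly differentiable. -/
lemma MemX.isWeakGrad (hΩ : IsOpen Ω) (hb : Bornology.IsBounded Ω) (hv : T.MemX v) :
    IsWeakGrad Ω v (gradient v) := by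
  have : IsFiniteMeasure (volume.restrict Ω) := ⟨by simpa using hb.measure_lt_top⟩
  have hvi : IntegrableOn v Ω := (hv.memLp hΩ hb 1).integrable le_rfl
  have hgi : IntegrableOn (gradient v) Ω := (hv.memLp_gradient hΩ hb 1).integrable le_rfl
  refine ⟨hvi.locallyIntegrableOn, hgi.locallyIntegrableOn, fun φ hφ i => ?_⟩
  set e : Plane := EuclideanSpace.single i 1 with he
  have hφ0 : ∀ x ∉ Ω, φ =ᶠ[𝓝 x] fun _ => 0 := fun x hx =>
    notMem_tsupport_iff_eventuallyEq.1 fun h => hx (hφ.2.2 h)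
  -- The product is Lipschitz on each element and zero off `Ω`, hence globally Lipschitz with
  -- compact support. Its directional derivative integrates to zero, and the a.e. product rule gives
  -- the weak formula with no edge terms.
  let w : Plane → ℝ := fun x => φ x * v x
  have hwc : HasCompactSupport w := hφ.2.1.mul_right
  have hlip : ∃ C, LipschitzWith C w := by
    choose! l hl using hv.2
    have h1 : ∀ K : T.elements, ∃ C, LipschitzWith C (fun x => φ x * l K.1 x) := fun K =>
      ContDiff.lipschitzWith_of_hasCompactSupport (𝕂 := ℝ) (n := 1) hφ.2.1.mul_right
        ((hφ.1.of_le (by simp)).mul (contDiff_affine _)) (by simp)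
    choose C hC using h1
    let F : Option T.elements → Set Plane := fun o => o.elim Ωᶜ fun K => K.1.carrier
    refine ⟨Finset.univ.sup C, lipschitzWith_of_finite_closed_cover (F := F) ?_ ?_ ?_⟩
    · rintro (_ | K)
      · exact hΩ.isClosed_compl
      · exact K.1.isClosed_carrier
    · intro x
      by_cases hx : x ∈ Ω
      · obtain ⟨K, hK, hxK⟩ := T.exists_mem_carrier (subset_closure hx)
        exact ⟨some ⟨K, hK⟩, hxK⟩
      · exact ⟨none, hx⟩
    · rintro (_ | K)
      · intro x hx y hy
        simp [w, (hφ0 x hx).eq_of_nhds, (hφ0 y hy).eq_of_nhds]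
      · have h2 : LipschitzOnWith (Finset.univ.sup C) (fun x => φ x * l K.1 x) K.1.carrier :=
          ((hC K).weaken (Finset.le_sup (Finset.mem_univ K))).lipschitzOnWith
        intro x hx y hy
        have := h2 hx hy
        simpa only [w, hl K.1 K.2 hx, hl K.1 K.2 hy] using this
  obtain ⟨C, hC⟩ := hlip
  have h0 := integral_lineDeriv_eq_zero hC hwc e
  have hout : ∀ x ∉ Ω, lineDeriv ℝ w x e = 0 := by
    intro x hx
    have : w =ᶠ[𝓝 x] fun _ => 0 := by
      filter_upwards [hφ0 x hx] with y hy
      simp [w, hy]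
    rw [this.lineDeriv_eq]
    simp [lineDeriv]
  rw [← setIntegral_eq_integral_of_forall_compl_eq_zero hout] at h0
  have hin : ∀ᵐ x ∂(volume.restrict Ω),
      lineDeriv ℝ w x e = v x * fderiv ℝ φ x e + gradient v x i * φ x := by
    filter_upwards [hv.ae_differentiableAt hΩ] with x hx
    have hφx : DifferentiableAt ℝ φ x := hφ.1.differentiable (by simp) x
    have hwx : DifferentiableAt ℝ w x := hφx.mul hx
    rw [hwx.lineDeriv_eq_fderiv, gradient_apply]
    simp only [w]
    rw [fderiv_fun_mul hφx hx]
    simp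
    ring
  rw [integral_congr_ae hin, integral_add
    ((hφ.fderiv_apply e).integrable_mul hvi.locallyIntegrableOn)
    (hφ.integrable_mul (locallyIntegrableOn_apply hgi.locallyIntegrableOn i))] at h0
  linarith

lemma MemX.memH1 (hΩ : IsOpen Ω) (hb : Bornology.IsBounded Ω) (hv : T.MemX v) : MemH1 Ω v :=
  ⟨hv.memLp hΩ hb 2, gradient v, hv.isWeakGrad hΩ hb, hv.memLp_gradient hΩ hb 2⟩

end Triangulation

/-! ### Convergence and mollification -/

/-- Dominated convergence with a constant majorant, integrable because the measure is finite. -/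
lemma tendsto_eLpNorm_two_zero_of_bounded {E : Type*} [NormedAddCommGroup E] {μ : Measure Plane}
    [IsFiniteMeasure μ] {F : ℕ → Plane → E} (hF : ∀ n, AEStronglyMeasurable (F n) μ) {C : ℝ}
    (hC : ∀ n, ∀ᵐ x ∂μ, ‖F n x‖ ≤ C) (h : ∀ᵐ x ∂μ, Tendsto (fun n => F n x) atTop (𝓝 0)) :
    Tendsto (fun n => eLpNorm (F n) 2 μ) atTop (𝓝 0) := by
  have h1 : ∀ n, eLpNorm (F n) 2 μ = (∫⁻ x, ‖F n x‖ₑ ^ (2 : ℝ) ∂μ) ^ (1 / 2 : ℝ) := fun n => by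
    rw [eLpNorm_eq_lintegral_rpow_enorm_toReal (by simp) (by simp)]
    simp
  have h2 : Tendsto (fun n => ∫⁻ x, ‖F n x‖ₑ ^ (2 : ℝ) ∂μ) atTop (𝓝 (∫⁻ _, 0 ∂μ)) := by
    refine tendsto_lintegral_of_dominated_convergence' (fun _ => ENNReal.ofReal C ^ (2 : ℝ))
      (fun n => (hF n).enorm.pow_const _) (fun n => ?_) ?_ ?_
    · filter_upwards [hC n] with x hx
      refine ENNReal.rpow_le_rpow ?_ (by norm_num)
      rw [← ofReal_norm]
      exact ENNReal.ofReal_le_ofReal hx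
    · rw [lintegral_const]
      exact ENNReal.mul_ne_top (ENNReal.rpow_ne_top_of_nonneg (by norm_num) ENNReal.ofReal_ne_top)
        (measure_ne_top _ _)
    · filter_upwards [h] with x hx
      have h3 := (ENNReal.continuous_rpow_const (y := 2)).tendsto _ |>.comp hx.enorm
      rw [enorm_zero, ENNReal.zero_rpow_of_pos (by norm_num)] at h3
      exact h3
  have h4 := (ENNReal.continuous_rpow_const (y := 1 / 2)).tendsto _ |>.comp h2
  simp only [lintegral_zero] at h4
  rw [ENNReal.zero_rpow_of_pos (by norm_num)] at h4
  refine h4.congr fun n => (h1 n).symm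

/-- The mollification of a function on the plane. -/
noncomputable def mollify (ρ : ContDiffBump (0 : Plane)) (s : Plane → ℝ) : Plane → ℝ :=
  convolution (ρ.normed volume) s (ContinuousLinearMap.lsmul ℝ ℝ) volume

section Mollify

variable {s : Plane → ℝ} (ρ : ContDiffBump (0 : Plane))

lemma mollify_eq (s : Plane → ℝ) (x : Plane) :
    mollify ρ s x = ∫ t, ρ.normed volume t * s (x - t) := rfl

lemma integrable_normed_mul (hs : Continuous s) (x : Plane) :
    Integrable fun t => ρ.normed volume t * s (x - t) := by
  refine Continuous.integrable_of_hasCompactSupport ?_ ρ.hasCompactSupport_normed.mul_right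
  exact ρ.continuous_normed.mul (by fun_prop)

lemma contDiff_mollify (hs : Continuous s) : ContDiff ℝ ∞ (mollify ρ s) :=
  ρ.hasCompactSupport_normed.contDiff_convolution_left (ContinuousLinearMap.lsmul ℝ ℝ)
    (ρ.contDiff_normed (n := ⊤)) hs.locallyIntegrable

lemma lipschitzWith_mollify {C : NNReal} (hs : LipschitzWith C s) :
    LipschitzWith C (mollify ρ s) := by
  refine LipschitzWith.of_dist_le_mul fun x y => ?_
  rw [Real.dist_eq, mollify_eq, mollify_eq, ← integral_sub (integrable_normed_mul ρ hs.continuous x)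
    (integrable_normed_mul ρ hs.continuous y), ← Real.norm_eq_abs]
  calc _ ≤ ∫ t, ρ.normed volume t * (C * dist x y) := by
        refine norm_integral_le_of_norm_le (ρ.integrable_normed.mul_const _)
          (.of_forall fun t => ?_)
        rw [← mul_sub, norm_mul, Real.norm_of_nonneg (ρ.nonneg_normed t)]
        refine mul_le_mul_of_nonneg_left ?_ (ρ.nonneg_normed t)
        have := hs.dist_le_mul (x - t) (y - t)
        rwa [Real.dist_eq, dist_sub_right] at this
    _ = C * dist x y := by rw [integral_mul_const, ρ.integral_normed, one_mul]

lemma abs_mollify_sub_le {C : NNReal} (hs : LipschitzWith C s) (x : Plane) :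
    |mollify ρ s x - s x| ≤ C * ρ.rOut := by
  rw [← Real.dist_eq]
  refine ContDiffBump.dist_normed_convolution_le hs.continuous.aestronglyMeasurable
    fun y hy => (hs.dist_le_mul y x).trans ?_
  exact mul_le_mul_of_nonneg_left (Metric.mem_ball.1 hy).le C.2

/-- A kernel of mass 1 and radius at most `η` preserves the increments of a function affine on the
ball of radius `2η`. The gradient is reproduced exactly, not merely in the limit. -/
lemma hasGradientAt_mollify (hs : Continuous s) {x c : Plane} {η : ℝ} (hη : ρ.rOut ≤ η)
    (h : ∀ y ∈ Metric.ball x (2 * η), s y = s x + inner ℝ c (y - x)) :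
    HasGradientAt (mollify ρ s) c x := by
  have hη0 : 0 < η := ρ.rOut_pos.trans_le hη
  have h1 : mollify ρ s =ᶠ[𝓝 x] fun z => mollify ρ s x + inner ℝ c (z - x) := by
    filter_upwards [Metric.ball_mem_nhds x hη0] with z hz
    rw [mollify_eq, mollify_eq]
    have h2 : ∀ t, ρ.normed volume t * s (z - t) =
        ρ.normed volume t * s (x - t) + ρ.normed volume t * inner ℝ c (z - x) := by
      intro t
      by_cases ht : t ∈ Metric.ball (0 : Plane) ρ.rOut
      · have ht' : ‖t‖ < η := by simpa using (Metric.mem_ball.1 ht).trans_le hη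
        have hz' : ‖z - x‖ < η := by simpa [dist_eq_norm] using hz
        rw [h (z - t), h (x - t), ← mul_add]
        · congr 1
          rw [add_assoc, ← inner_add_right]
          congr 3
          abel
        · rw [Metric.mem_ball, dist_eq_norm]
          have : x - t - x = -t := by abel
          rw [this, norm_neg]; linarith
        · rw [Metric.mem_ball, dist_eq_norm]
          have : z - t - x = (z - x) - t := by abel
          rw [this]
          linarith [norm_sub_le (z - x) t]
      · have : ρ.normed volume t = 0 := by
          rw [← Function.notMem_support, ρ.support_normed_eq]
          exact ht
        simp [this]
    simp only [h2]
    rw [integral_add (integrable_normed_mul ρ hs x) (ρ.integrable_normed.mul_const _),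
      integral_mul_const, ρ.integral_normed, one_mul]
  refine HasGradientAt.congr_of_eventuallyEq ?_ h1
  rw [hasGradientAt_iff_hasFDerivAt]
  have h3 : (fun z => mollify ρ s x + inner ℝ c (z - x)) =
      fun z => innerSL ℝ c z + (mollify ρ s x - inner ℝ c x) := by
    ext z
    rw [inner_sub_right, innerSL_apply_apply]
    ring
  rw [h3]
  exact ((innerSL ℝ c).hasFDerivAt).add_const _

end Mollify

/-! ### Soft thresholding -/

/-- Soft thresholding at level `ε`. -/
noncomputable def shrink (ε t : ℝ) : ℝ := t - max (-ε) (min ε t)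

lemma abs_shrink_sub_le (ε s t : ℝ) (hε : 0 ≤ ε) : |shrink ε s - shrink ε t| ≤ |s - t| := by
  unfold shrink
  grind

lemma abs_shrink_sub_self_le (ε t : ℝ) (hε : 0 ≤ ε) : |shrink ε t - t| ≤ ε := by
  unfold shrink
  grind

lemma shrink_of_abs_le {ε t : ℝ} (h : |t| ≤ ε) : shrink ε t = 0 := by
  unfold shrink
  grind

lemma shrink_of_le {ε t : ℝ} (hε : 0 ≤ ε) (h : ε ≤ t) : shrink ε t = t - ε := by
  unfold shrink
  grind

lemma shrink_of_le_neg {ε t : ℝ} (hε : 0 ≤ ε) (h : t ≤ -ε) : shrink ε t = t + ε := by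
  unfold shrink
  grind

lemma lipschitzWith_shrink {ε : ℝ} (hε : 0 ≤ ε) : LipschitzWith 1 (shrink ε) :=
  LipschitzWith.of_dist_le_mul fun s t => by
    simpa [Real.dist_eq] using abs_shrink_sub_le ε s t hε

lemma norm_gradient_le_of_lipschitz {f : Plane → ℝ} {C : NNReal} (hf : LipschitzWith C f)
    (x : Plane) : ‖gradient f x‖ ≤ C := by
  rw [gradient, LinearIsometryEquiv.norm_map]
  exact norm_fderiv_le_of_lipschitz ℝ hf

/-- The zero set is a proper affine subspace, hence null. -/
lemma ae_affine_ne_zero {l : Plane →ᵃ[ℝ] ℝ} (hl : affineGrad l ≠ 0) : ∀ᵐ x, l x ≠ 0 := by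
  let S : AffineSubspace ℝ Plane := (AffineSubspace.mk' (0 : ℝ) ⊥).comap l
  have hS : ∀ x, x ∈ S ↔ l x = 0 := fun x => by simp [S]
  have hne : S ≠ ⊤ := by
    intro h
    apply hl
    have h0 : ∀ x, l x = 0 := fun x => (hS x).1 (h ▸ AffineSubspace.mem_top ℝ Plane x)
    have := inner_affineGrad l (affineGrad l) 0
    rw [h0, h0] at this
    simpa using this
  have := measure_eq_zero_iff_ae_notMem.1 (Measure.addHaar_affineSubspace volume S hne)
  filter_upwards [this] with x hx hx0
  exact hx ((hS x).2 hx0)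

/-! ### Finite element functions in `H¹₀` -/

namespace Triangulation

variable {T : Triangulation Ω}

lemma lipschitzWith_affine {l : Plane →ᵃ[ℝ] ℝ} {C : NNReal} (h : ‖affineGrad l‖ ≤ C) :
    LipschitzWith C l := by
  refine LipschitzWith.of_dist_le_mul fun x y => ?_
  rw [Real.dist_eq, ← inner_affineGrad, dist_eq_norm]
  exact (abs_real_inner_le_norm _ _).trans (mul_le_mul_of_nonneg_right h (norm_nonneg _))

lemma MemX.indicator_eqOn (hΩ : IsOpen Ω) (h0 : ∀ x ∈ frontier Ω, v x = 0) :
    Set.EqOn (Ω.indicator v) v (closure Ω) := by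
  intro x hx
  by_cases hxΩ : x ∈ Ω
  · exact Set.indicator_of_mem hxΩ v
  · rw [Set.indicator_of_notMem hxΩ, h0 x]
    rw [hΩ.frontier_eq]
    exact ⟨hx, hxΩ⟩

lemma MemX.lipschitzWith_indicator (hΩ : IsOpen Ω) (hv : T.MemX v)
    (h0 : ∀ x ∈ frontier Ω, v x = 0) : ∃ C, LipschitzWith C (Ω.indicator v) := by
  obtain ⟨C, hC⟩ := hv.exists_norm_affineGrad_le
  let F : Option T.elements → Set Plane := fun o => o.elim Ωᶜ fun K => K.1.carrier
  refine ⟨C, lipschitzWith_of_finite_closed_cover (F := F) ?_ ?_ ?_⟩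
  · rintro (_ | K)
    · exact hΩ.isClosed_compl
    · exact K.1.isClosed_carrier
  · intro x
    by_cases hx : x ∈ Ω
    · obtain ⟨K, hK, hxK⟩ := T.exists_mem_carrier (subset_closure hx)
      exact ⟨some ⟨K, hK⟩, hxK⟩
    · exact ⟨none, hx⟩
  · rintro (_ | K)
    · intro x hx y hy
      rw [Set.indicator_of_notMem hx, Set.indicator_of_notMem hy]
      simp
    · obtain ⟨l, hl, hlC⟩ := hC K.1 K.2
      intro x hx y hy
      rw [MemX.indicator_eqOn hΩ h0 (T.carrier_subset K.2 hx),
        MemX.indicator_eqOn hΩ h0 (T.carrier_subset K.2 hy), hl hx, hl hy]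
      exact lipschitzWith_affine hlC x y

/-- Finite element functions that vanish on the boundary belong to `H¹₀`. -/
lemma MemX.memH10 (hΩ : IsOpen Ω) (hb : Bornology.IsBounded Ω)
    (hv : T.MemX v) (h0 : ∀ x ∈ frontier Ω, v x = 0) : MemH10 Ω v := by
  have : IsFiniteMeasure (volume.restrict Ω) := ⟨by simpa using hb.measure_lt_top⟩
  refine ⟨hv.memH1 hΩ hb, ?_⟩
  obtain ⟨C, hC⟩ := hv.lipschitzWith_indicator hΩ h0
  set vb : Plane → ℝ := Ω.indicator v with hvb
  let ε : ℕ → ℝ := fun n => 1 / ((n : ℝ) + 1)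
  have hε : ∀ n, 0 < ε n := fun n => by positivity
  have hεt : Tendsto ε atTop (𝓝 0) := tendsto_one_div_add_atTop_nhds_zero_nat
  have hC1 : (0 : ℝ) < 2 * (C + 1) := by positivity
  -- The radius is chosen so that a `C`-Lipschitz function varies by at most `ε n / 2` across the
  -- kernel.
  let ρ : ℕ → ContDiffBump (0 : Plane) := fun n =>
    ⟨ε n / (2 * (C + 1)) / 2, ε n / (2 * (C + 1)), by have := hε n; positivity,
      half_lt_self (div_pos (hε n) hC1)⟩
  have hρ : ∀ n, (ρ n).rOut = ε n / (2 * (C + 1)) := fun n => rfl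
  have hρt : Tendsto (fun n => (ρ n).rOut) atTop (𝓝 0) := by
    have := hεt.div_const (2 * ((C : ℝ) + 1))
    rwa [zero_div] at this
  have hCρ : ∀ n, C * (ρ n).rOut ≤ ε n / 2 := fun n => by
    rw [hρ, ← div_div, mul_div_assoc', div_le_iff₀ (by positivity)]
    have := hε n
    have := C.2
    nlinarith
  -- Thresholding kills `vb` where `|vb| ≤ ε n`, in particular near the boundary; mollification then
  -- keeps the support in `{ε n / 2 ≤ |vb|}`, a subset of `Ω`.
  let s : ℕ → Plane → ℝ := fun n x => shrink (ε n) (vb x)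
  have hs : ∀ n, LipschitzWith C (s n) := fun n => by
    have := (lipschitzWith_shrink (hε n).le).comp hC
    rwa [one_mul] at this
  let φ : ℕ → Plane → ℝ := fun n => mollify (ρ n) (s n)
  have hsupp : ∀ n, tsupport (φ n) ⊆ {x | ε n / 2 ≤ |vb x|} := by
    intro n
    refine closure_minimal ?_ (isClosed_le continuous_const hC.continuous.abs)
    intro x hx
    by_contra hcon
    rw [Set.mem_ofPred_eq, not_le] at hcon
    have hzero : ∀ y ∈ Metric.ball x (ρ n).rOut, s n y = 0 := by
      intro y hy
      refine shrink_of_abs_le ?_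
      have h1 := hC.dist_le_mul y x
      rw [Real.dist_eq] at h1
      have h2 : C * dist y x ≤ C * (ρ n).rOut :=
        mul_le_mul_of_nonneg_left (Metric.mem_ball.1 hy).le C.2
      have h3 := abs_sub_abs_le_abs_sub (vb y) (vb x)
      linarith [hCρ n]
    have hx0 : s n x = 0 := hzero x (Metric.mem_ball_self (ρ n).rOut_pos)
    have : mollify (ρ n) (s n) x = s n x :=
      ContDiffBump.normed_convolution_eq_right fun y hy => by rw [hzero y hy, hx0]
    exact hx (this.trans hx0)
  have hsubΩ : ∀ n, {x | ε n / 2 ≤ |vb x|} ⊆ Ω := by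
    intro n x hx
    by_contra hxΩ
    have : vb x = 0 := Set.indicator_of_notMem hxΩ v
    rw [Set.mem_ofPred_eq, this, abs_zero] at hx
    linarith [hε n]
  have htest : ∀ n, IsTest Ω (φ n) := fun n => by
    refine ⟨contDiff_mollify (ρ n) (hs n).continuous, ?_, (hsupp n).trans (hsubΩ n)⟩
    exact Metric.isCompact_of_isClosed_isBounded (isClosed_tsupport _)
      (hb.subset ((hsupp n).trans (hsubΩ n)))
  refine ⟨φ, htest, ?_, ?_⟩
  · have hclose : ∀ n, ∀ x ∈ Ω, ‖v x - φ n x‖ ≤ 2 * ε n := by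
      intro n x hx
      have h1 := abs_mollify_sub_le (ρ n) (hs n) x
      have h2 := abs_shrink_sub_self_le (ε n) (vb x) (hε n).le
      have h3 : vb x = v x := Set.indicator_of_mem hx v
      rw [Real.norm_eq_abs, ← h3]
      have h4 := abs_sub_le (vb x) (s n x) (φ n x)
      rw [abs_sub_comm (vb x) (s n x), abs_sub_comm (s n x) (φ n x)] at h4
      have h5 : |φ n x - s n x| ≤ C * (ρ n).rOut := h1
      have h6 : |s n x - vb x| ≤ ε n := h2
      linarith [hCρ n, hε n]
    have hε1 : ∀ n, ε n ≤ 1 := fun n => by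
      simp only [ε]
      rw [div_le_one (by positivity)]
      have : (0 : ℝ) ≤ n := n.cast_nonneg
      linarith
    refine tendsto_eLpNorm_two_zero_of_bounded (C := 2) (fun n => ?_) (fun n => ?_) ?_
    · exact (hv.memLp hΩ hb 2).1.sub (htest n).1.continuous.aestronglyMeasurable
    · filter_upwards [ae_restrict_mem hΩ.measurableSet] with x hx
      linarith [hclose n x hx, hε1 n]
    · filter_upwards [ae_restrict_mem hΩ.measurableSet] with x hx
      refine squeeze_zero_norm (hclose · x hx) ?_
      simpa using hεt.const_mul 2
  · have hgr := (hv.isWeakGrad hΩ hb).weakGrad_ae_eq hΩ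
    have hcongr : ∀ n, eLpNorm (fun x => weakGrad Ω v x - gradient (φ n) x) 2 (volume.restrict Ω) =
        eLpNorm (fun x => gradient v x - gradient (φ n) x) 2 (volume.restrict Ω) := fun n =>
      eLpNorm_congr_ae (by filter_upwards [hgr] with x hx; rw [hx])
    simp only [hcongr]
    obtain ⟨D, hD⟩ := hv.exists_norm_gradient_le hΩ
    refine tendsto_eLpNorm_two_zero_of_bounded (C := D + C) (fun n => ?_) (fun n => ?_) ?_
    · exact ((measurable_gradient v).sub (measurable_gradient (φ n))).aestronglyMeasurable
    · filter_upwards [hD] with x hx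
      refine (norm_sub_le _ _).trans (add_le_add hx ?_)
      exact norm_gradient_le_of_lipschitz (lipschitzWith_mollify (ρ n) (hs n)) x
    · choose! l hl using hv.2
      have hnz : ∀ᵐ x ∂(volume.restrict Ω), ∀ K ∈ T.elements, affineGrad (l K) ≠ 0 → l K x ≠ 0 :=
        (T.elements.eventually_all).2 fun K _ => by
          by_cases h : affineGrad (l K) = 0
          · exact .of_forall fun x h' => absurd h h'
          · exact (ae_restrict_of_ae (ae_affine_ne_zero h)).mono fun x hx _ => hx
      filter_upwards [T.ae_exists_mem_interior hΩ, hnz] with x ⟨K, hK, hx⟩ hxnz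
      have hgx : gradient v x = affineGrad (l K) := (hasGradientAt_of_eqOn (hl K hK) hx).gradient
      have hvbl : ∀ y ∈ K.carrier, vb y = l K y := fun y hy => by
        rw [hvb, MemX.indicator_eqOn hΩ h0 (T.carrier_subset hK hy), hl K hK hy]
      have hKn : ∀ᶠ y in 𝓝 x, y ∈ K.carrier := mem_interior_iff_mem_nhds.1 hx
      have hlc : Continuous (l K) := continuous_affine (l K)
      have hlin : ∀ y, l K y = l K x + inner ℝ (affineGrad (l K)) (y - x) := fun y => by
        rw [inner_affineGrad]; ring
      -- Almost every `x` is interior to an element on which either `v x ≠ 0` or `v` vanishes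
      -- identically. Near such a point thresholding, for large `n`, is a shift by `± ε n` or does
      -- nothing, so `s n` has the slope of `v` on a fixed ball.
      have hev : ∃ η > 0, ∀ᶠ n in atTop, ∀ y ∈ Metric.ball x (2 * η),
          s n y = s n x + inner ℝ (affineGrad (l K)) (y - x) := by
        have hball : ∀ p : Plane → Prop, (∀ᶠ y in 𝓝 x, p y) →
            ∃ η > 0, ∀ y ∈ Metric.ball x (2 * η), p y := fun p hp => by
          obtain ⟨η, hη, h⟩ := Metric.eventually_nhds_iff_ball.1 hp
          exact ⟨η / 2, by positivity, fun y hy => h y (by rwa [mul_div_cancel₀ _ two_ne_zero] at hy)⟩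
        rcases lt_trichotomy (l K x) 0 with hneg | hzero | hpos
        · obtain ⟨η, hη, h⟩ := hball _
            (hKn.and (hlc.continuousAt.eventually (gt_mem_nhds (show l K x < l K x / 2 by linarith))))
          refine ⟨η, hη, ?_⟩
          filter_upwards [hεt.eventually (gt_mem_nhds (show 0 < - (l K x / 2) by linarith))] with n hn y hy
          have hxx := h x (Metric.mem_ball_self (by positivity))
          simp only [s]
          rw [hvbl y (h y hy).1, hvbl x hxx.1, shrink_of_le_neg (hε n).le (by linarith [(h y hy).2]),
            shrink_of_le_neg (hε n).le (by linarith), hlin y]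
          ring
        · have hg0 : affineGrad (l K) = 0 := by
            by_contra hne
            exact hxnz K hK hne hzero
          obtain ⟨η, hη, h⟩ := hball _ hKn
          refine ⟨η, hη, .of_forall fun n y hy => ?_⟩
          simp only [s]
          rw [hvbl y (h y hy), hvbl x (h x (Metric.mem_ball_self (by positivity))), hlin y, hg0]
          simp
        · obtain ⟨η, hη, h⟩ := hball _
            (hKn.and (hlc.continuousAt.eventually (lt_mem_nhds (show l K x / 2 < l K x by linarith))))
          refine ⟨η, hη, ?_⟩
          filter_upwards [hεt.eventually (gt_mem_nhds (show 0 < l K x / 2 by linarith))] with n hn y hy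
          have hxx := h x (Metric.mem_ball_self (by positivity))
          simp only [s]
          rw [hvbl y (h y hy).1, hvbl x hxx.1, shrink_of_le (hε n).le (by linarith [(h y hy).2]),
            shrink_of_le (hε n).le (by linarith), hlin y]
          ring
      obtain ⟨η, hη, hev⟩ := hev
      refine tendsto_const_nhds.congr' ?_
      filter_upwards [hev, hρt.eventually (gt_mem_nhds hη)] with n hn hn'
      rw [hgx, (hasGradientAt_mollify (ρ n) (hs n).continuous hn'.le hn).gradient, sub_self]

end Triangulation

/-! ### Friedrichs' inequality -/

/-- Write `φ² = φ² ∂₁x₁` and integrate by parts. Young's inequality bounds `-2 x₁ φ ∂₁φ` by `φ²/2 +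
2R²|∇φ|²`; absorbing the first term yields the factor `4R²`. -/
lemma IsTest.integral_sq_le {Ω : Set Plane} {R : ℝ} (hR : ∀ x ∈ Ω, ‖x‖ ≤ R) {φ : Plane → ℝ}
    (hφ : IsTest Ω φ) : ∫ x in Ω, φ x ^ 2 ≤ 4 * R ^ 2 * ∫ x in Ω, ‖gradient φ x‖ ^ 2 := by
  obtain ⟨h1, h2, h3⟩ := hφ
  have hz : ∀ x ∉ Ω, φ x = 0 := fun x hx => image_eq_zero_of_notMem_tsupport fun h => hx (h3 h)
  have hgz : ∀ x ∉ Ω, gradient φ x = 0 := fun x hx => by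
    rw [(notMem_tsupport_iff_eventuallyEq.1 fun h => hx (h3 h) : φ =ᶠ[𝓝 x] 0).gradient_eq]
    exact gradient_fun_const x 0
  rw [setIntegral_eq_integral_of_forall_compl_eq_zero fun x hx => by rw [hz x hx]; simp,
    setIntegral_eq_integral_of_forall_compl_eq_zero fun x hx => by rw [hgz x hx]; simp]
  let e : Plane := EuclideanSpace.single 0 1
  let p : Plane →L[ℝ] ℝ := EuclideanSpace.proj 0
  have hpe : p e = 1 := by simp [p, e]
  have hd : Differentiable ℝ φ := h1.differentiable (by simp)
  have hcd : Continuous (fderiv ℝ φ) := h1.continuous_fderiv (by simp)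
  have hfd : ∀ x, fderiv ℝ (fun x => φ x ^ 2) x e = 2 * φ x * fderiv ℝ φ x e := fun x => by
    rw [fderiv_fun_pow _ (hd x)]; simp
  have hfp : ∀ x, fderiv ℝ p x e = 1 := fun x => by rw [p.fderiv, hpe]
  have hc2 : HasCompactSupport fun x => φ x ^ 2 := by
    simp only [sq]
    exact h2.mul_right (f' := φ)
  have i1 : Integrable fun x => φ x ^ 2 :=
    (h1.continuous.pow 2).integrable_of_hasCompactSupport hc2
  have hgc : Continuous (gradient φ) :=
    (InnerProductSpace.toDual ℝ Plane).symm.continuous.comp hcd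
  have i2 : Integrable fun x => ‖gradient φ x‖ ^ 2 := by
    refine (hgc.norm.pow 2).integrable_of_hasCompactSupport ?_
    refine h2.mono' fun x hx => ?_
    by_contra hcon
    have h4 : gradient φ x = 0 := by
      rw [(notMem_tsupport_iff_eventuallyEq.1 hcon).gradient_eq]
      exact gradient_fun_const x 0
    exact hx (by simp [h4])
  have i3 : Integrable fun x => p x * (2 * φ x * fderiv ℝ φ x e) := by
    refine Continuous.integrable_of_hasCompactSupport (by fun_prop) ?_
    refine h2.mono fun x hx => ?_
    simp only [Function.mem_support] at *
    exact fun h => hx (by simp [h])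
  have hibp := integral_mul_fderiv_eq_neg_fderiv_mul_of_integrable (μ := volume) (f := p)
    (g := fun x => φ x ^ 2) (v := e) (by simpa only [hfp, one_mul] using i1)
    (by simpa only [hfd] using i3)
    (by
      refine Continuous.integrable_of_hasCompactSupport (by fun_prop) ?_
      exact hc2.mul_left)
    (fun x _ => p.differentiableAt) (fun x _ => (hd x).pow 2)
  simp only [hfd, hfp, one_mul] at hibp
  have hpt : ∀ x, -(p x * (2 * φ x * fderiv ℝ φ x e)) ≤
      (1 / 2) * φ x ^ 2 + 2 * R ^ 2 * ‖gradient φ x‖ ^ 2 := by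
    intro x
    by_cases hx : x ∈ Ω
    · have hb1 : |p x| ≤ R := by
        have h5 : |x 0| ≤ ‖x‖ := by simpa using PiLp.norm_apply_le x 0
        exact h5.trans (hR x hx)
      have hb2 : |fderiv ℝ φ x e| ≤ ‖gradient φ x‖ := by
        rw [← inner_gradient_left]
        refine (abs_real_inner_le_norm _ _).trans ?_
        simp [e]
      have hR0 : 0 ≤ R := (abs_nonneg _).trans hb1
      have hb3 : |p x * fderiv ℝ φ x e| ≤ R * ‖gradient φ x‖ := by
        rw [abs_mul]
        exact mul_le_mul hb1 hb2 (abs_nonneg _) hR0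
      have hb4 : (p x * fderiv ℝ φ x e) ^ 2 ≤ (R * ‖gradient φ x‖) ^ 2 :=
        sq_le_sq.2 (hb3.trans (le_abs_self _))
      nlinarith [sq_nonneg (φ x + 2 * (p x * fderiv ℝ φ x e))]
    · rw [hz x hx]
      simp
      positivity
  have hle := integral_mono i3.neg ((i1.const_mul (1 / 2)).add (i2.const_mul (2 * R ^ 2))) hpt
  have e1 : ∫ x, (-fun x => p x * (2 * φ x * fderiv ℝ φ x e)) x =
      ∫ x, φ x ^ 2 := by
    rw [integral_neg', hibp, neg_neg]
  rw [e1] at hle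
  rw [integral_add' (i1.const_mul (1 / 2)) (i2.const_mul (2 * R ^ 2)), integral_const_mul,
    integral_const_mul] at hle
  linarith

lemma eLpNorm_two_eq {E : Type*} [NormedAddCommGroup E] {μ : Measure Plane} {f : Plane → E}
    (hf : MemLp f 2 μ) : eLpNorm f 2 μ = ENNReal.ofReal (√(∫ x, ‖f x‖ ^ 2 ∂μ)) := by
  rw [hf.eLpNorm_eq_integral_rpow_norm (by simp) (by simp), Real.sqrt_eq_rpow]
  simp

lemma IsTest.eLpNorm_le {Ω : Set Plane} {R : ℝ} (hR0 : 0 ≤ R)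
    (hR : ∀ x ∈ Ω, ‖x‖ ≤ R) {φ : Plane → ℝ} (hφ : IsTest Ω φ) :
    eLpNorm φ 2 (volume.restrict Ω) ≤
      ENNReal.ofReal (2 * R) * eLpNorm (gradient φ) 2 (volume.restrict Ω) := by
  have h1 : MemLp φ 2 (volume.restrict Ω) :=
    (hφ.1.continuous.memLp_of_hasCompactSupport hφ.2.1).restrict _
  have hgc : Continuous (gradient φ) :=
    (InnerProductSpace.toDual ℝ Plane).symm.continuous.comp (hφ.1.continuous_fderiv (by simp))
  have h2 : MemLp (gradient φ) 2 (volume.restrict Ω) :=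
    (hgc.memLp_of_hasCompactSupport
      ((hφ.2.1.fderiv ℝ).comp_left (g := (InnerProductSpace.toDual ℝ Plane).symm) (by simp))).restrict _
  rw [eLpNorm_two_eq h1, eLpNorm_two_eq h2, ← ENNReal.ofReal_mul (by positivity)]
  refine ENNReal.ofReal_le_ofReal ?_
  refine Real.sqrt_le_iff.2 ⟨by positivity, ?_⟩
  rw [mul_pow, Real.sq_sqrt (integral_nonneg fun x => by positivity)]
  have := hφ.integral_sq_le hR
  simp only [Real.norm_eq_abs, sq_abs]
  linarith

/-- Friedrichs' inequality passes to the limit along the approximating test functions, whose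
gradients tend to zero in `L²`. This gives uniqueness in the discrete problem. -/
lemma MemH10.ae_eq_zero {Ω : Set Plane} (hb : Bornology.IsBounded Ω) {v : Plane → ℝ}
    (hv : MemH10 Ω v) (h0 : weakGrad Ω v =ᵐ[volume.restrict Ω] 0) :
    v =ᵐ[volume.restrict Ω] 0 := by
  obtain ⟨R, hR⟩ := hb.subset_closedBall (0 : Plane)
  have hR' : ∀ x ∈ Ω, ‖x‖ ≤ max R 0 := fun x hx => by
    have := hR hx
    rw [mem_closedBall_zero_iff] at this
    exact this.trans (le_max_left _ _)
  obtain ⟨φ, hφ, hφ1, hφ2⟩ := hv.2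
  have hg : ∀ n, eLpNorm (fun x => weakGrad Ω v x - gradient (φ n) x) 2 (volume.restrict Ω) =
      eLpNorm (gradient (φ n)) 2 (volume.restrict Ω) := fun n => by
    rw [← eLpNorm_neg]
    refine eLpNorm_congr_ae ?_
    filter_upwards [h0] with x hx
    simp [hx]
  simp only [hg] at hφ2
  have hle : ∀ n, eLpNorm v 2 (volume.restrict Ω) ≤
      eLpNorm (fun x => v x - φ n x) 2 (volume.restrict Ω) +
      ENNReal.ofReal (2 * max R 0) * eLpNorm (gradient (φ n)) 2 (volume.restrict Ω) := by
    intro n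
    have hm : AEStronglyMeasurable (φ n) (volume.restrict Ω) :=
      (hφ n).1.continuous.aestronglyMeasurable
    have h1 := eLpNorm_add_le (p := 2) (hv.1.1.1.sub hm) hm (by norm_num)
    rw [sub_add_cancel] at h1
    exact h1.trans (add_le_add le_rfl ((hφ n).eLpNorm_le (le_max_right _ _) hR'))
  have hlim := hφ1.add (ENNReal.Tendsto.const_mul (a := ENNReal.ofReal (2 * max R 0)) hφ2
    (Or.inr ENNReal.ofReal_ne_top))
  simp only [mul_zero, add_zero] at hlim
  have hz : eLpNorm v 2 (volume.restrict Ω) = 0 := le_antisymm (ge_of_tendsto' hlim hle) zero_le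
  exact (eLpNorm_eq_zero_iff hv.1.1.1 (by simp)).1 hz

/-! ### The vector space structure of `H¹₀` -/

lemma MemH1.add (hv : MemH1 Ω v) (hw : MemH1 Ω w) : MemH1 Ω (fun x => v x + w x) := by
  obtain ⟨h1, G, hG, hG'⟩ := hv
  obtain ⟨h2, H, hH, hH'⟩ := hw
  exact ⟨h1.add h2, _, hG.add hH, hG'.add hH'⟩

lemma MemH1.const_mul (hv : MemH1 Ω v) (c : ℝ) : MemH1 Ω (fun x => c * v x) := by
  obtain ⟨h1, G, hG, hG'⟩ := hv
  exact ⟨h1.const_mul c, _, hG.const_mul c, hG'.const_smul c⟩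

lemma MemH1.sub (hv : MemH1 Ω v) (hw : MemH1 Ω w) : MemH1 Ω (fun x => v x - w x) := by
  simpa [sub_eq_add_neg] using hv.add (hw.const_mul (-1))

lemma MemH1.congr (hΩ : IsOpen Ω) (hv : MemH1 Ω v) (h : Set.EqOn v w Ω) : MemH1 Ω w := by
  obtain ⟨h1, G, hG, hG'⟩ := hv
  refine ⟨h1.ae_eq ?_, G, hG.congr_left hΩ h, hG'⟩
  filter_upwards [ae_restrict_mem hΩ.measurableSet] with x hx using h hx

lemma weakGrad_congr (hΩ : IsOpen Ω) (hv : MemH1 Ω v) (h : Set.EqOn v w Ω) :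
    weakGrad Ω w =ᵐ[volume.restrict Ω] weakGrad Ω v := by
  obtain ⟨h1, G, hG, hG'⟩ := hv
  exact ((hG.congr_left hΩ h).weakGrad_ae_eq hΩ).trans (hG.weakGrad_ae_eq hΩ).symm

lemma MemH1.aestronglyMeasurable_weakGrad (hΩ : IsOpen Ω) (hv : MemH1 Ω v) :
    AEStronglyMeasurable (weakGrad Ω v) (volume.restrict Ω) := by
  obtain ⟨h1, G, hG, hG'⟩ := hv
  exact hG'.1.congr (hG.weakGrad_ae_eq hΩ).symm

lemma IsTest.add {φ ψ : Plane → ℝ} (hφ : IsTest Ω φ) (hψ : IsTest Ω ψ) :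
    IsTest Ω (fun x => φ x + ψ x) :=
  ⟨hφ.1.add hψ.1, hφ.2.1.add hψ.2.1,
    (tsupport_add φ ψ).trans (Set.union_subset hφ.2.2 hψ.2.2)⟩

lemma IsTest.const_mul {φ : Plane → ℝ} (hφ : IsTest Ω φ) (c : ℝ) :
    IsTest Ω (fun x => c * φ x) := by
  refine ⟨contDiff_const.mul hφ.1, hφ.2.1.mul_left, ?_⟩
  exact (closure_mono fun x hx => right_ne_zero_of_mul hx).trans hφ.2.2

lemma gradient_fun_add {x : Plane} (hv : DifferentiableAt ℝ v x) (hw : DifferentiableAt ℝ w x) :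
    gradient (fun x => v x + w x) x = gradient v x + gradient w x := by
  simp only [gradient, fderiv_fun_add hv hw, map_add]

lemma gradient_fun_const_mul {x : Plane} (hv : DifferentiableAt ℝ v x) (c : ℝ) :
    gradient (fun x => c * v x) x = c • gradient v x := by
  simp only [gradient, fderiv_const_mul hv, map_smul]

lemma MemH10.add (hΩ : IsOpen Ω) (hv : MemH10 Ω v) (hw : MemH10 Ω w) :
    MemH10 Ω (fun x => v x + w x) := by
  refine ⟨hv.1.add hw.1, ?_⟩
  obtain ⟨φ, hφ, hφ1, hφ2⟩ := hv.2
  obtain ⟨ψ, hψ, hψ1, hψ2⟩ := hw.2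
  refine ⟨fun n x => φ n x + ψ n x, fun n => (hφ n).add (hψ n), ?_, ?_⟩
  · have hlim := hφ1.add hψ1
    rw [add_zero] at hlim
    refine tendsto_of_tendsto_of_tendsto_of_le_of_le tendsto_const_nhds hlim (fun _ => zero_le)
      fun n => ?_
    have h := eLpNorm_add_le (p := 2)
      (hv.1.1.1.sub (hφ n).1.continuous.aestronglyMeasurable)
      (hw.1.1.1.sub (hψ n).1.continuous.aestronglyMeasurable) (by norm_num)
    refine le_trans (le_of_eq ?_) h
    congr 1
    ext x
    simp only [Pi.add_apply, Pi.sub_apply]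
    ring
  · have hlim := hφ2.add hψ2
    rw [add_zero] at hlim
    refine tendsto_of_tendsto_of_tendsto_of_le_of_le tendsto_const_nhds hlim (fun _ => zero_le)
      fun n => ?_
    have h := eLpNorm_add_le (p := 2)
      ((hv.1.aestronglyMeasurable_weakGrad hΩ).sub (measurable_gradient (φ n)).aestronglyMeasurable)
      ((hw.1.aestronglyMeasurable_weakGrad hΩ).sub (measurable_gradient (ψ n)).aestronglyMeasurable)
      (by norm_num)
    refine le_trans (le_of_eq (eLpNorm_congr_ae ?_)) h
    obtain ⟨_, G, hG, _⟩ := hv.1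
    obtain ⟨_, H, hH, _⟩ := hw.1
    filter_upwards [hG.weakGrad_ae_eq hΩ, hH.weakGrad_ae_eq hΩ, (hG.add hH).weakGrad_ae_eq hΩ]
      with x h1 h2 h3
    rw [h3, gradient_fun_add ((hφ n).1.differentiable (by simp) x)
      ((hψ n).1.differentiable (by simp) x)]
    simp only [Pi.add_apply, Pi.sub_apply, h1, h2]
    abel

lemma MemH10.const_mul (hΩ : IsOpen Ω) (hv : MemH10 Ω v) (c : ℝ) :
    MemH10 Ω (fun x => c * v x) := by
  refine ⟨hv.1.const_mul c, ?_⟩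
  obtain ⟨φ, hφ, hφ1, hφ2⟩ := hv.2
  refine ⟨fun n x => c * φ n x, fun n => (hφ n).const_mul c, ?_, ?_⟩
  · have hlim := ENNReal.Tendsto.const_mul (a := ‖c‖ₑ) hφ1 (Or.inr enorm_ne_top)
    rw [mul_zero] at hlim
    refine hlim.congr fun n => ?_
    rw [← eLpNorm_const_smul]
    congr 1
    ext x
    simp only [Pi.smul_apply, smul_eq_mul]
    ring
  · have hlim := ENNReal.Tendsto.const_mul (a := ‖c‖ₑ) hφ2 (Or.inr enorm_ne_top)
    rw [mul_zero] at hlim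
    refine hlim.congr fun n => ?_
    rw [← eLpNorm_const_smul]
    obtain ⟨_, G, hG, _⟩ := hv.1
    refine eLpNorm_congr_ae ?_
    filter_upwards [hG.weakGrad_ae_eq hΩ, (hG.const_mul c).weakGrad_ae_eq hΩ] with x h1 h2
    rw [h2, gradient_fun_const_mul ((hφ n).1.differentiable (by simp) x)]
    simp only [Pi.smul_apply, h1, smul_sub]

lemma MemH10.congr (hΩ : IsOpen Ω) (hv : MemH10 Ω v) (h : Set.EqOn v w Ω) : MemH10 Ω w := by
  refine ⟨hv.1.congr hΩ h, ?_⟩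
  obtain ⟨φ, hφ, hφ1, hφ2⟩ := hv.2
  refine ⟨φ, hφ, hφ1.congr fun n => eLpNorm_congr_ae ?_, hφ2.congr fun n => eLpNorm_congr_ae ?_⟩
  · filter_upwards [ae_restrict_mem hΩ.measurableSet] with x hx
    rw [h hx]
  · filter_upwards [weakGrad_congr hΩ hv.1 h] with x hx
    rw [hx]

/-! ### The discrete problem -/

namespace Triangulation

variable {T : Triangulation Ω} {f g : Plane → ℝ}

lemma MemX.weakGrad_ae_eq (hΩ : IsOpen Ω) (hb : Bornology.IsBounded Ω) (hv : T.MemX v) :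
    weakGrad Ω v =ᵐ[volume.restrict Ω] gradient v := (hv.isWeakGrad hΩ hb).weakGrad_ae_eq hΩ

lemma MemX.bilin_eq (hΩ : IsOpen Ω) (hb : Bornology.IsBounded Ω) (hv : T.MemX v)
    (hw : T.MemX w) : bilin Ω v w = ∫ x in Ω, inner ℝ (gradient v x) (gradient w x) := by
  refine integral_congr_ae ?_
  filter_upwards [hv.weakGrad_ae_eq hΩ hb, hw.weakGrad_ae_eq hΩ hb] with x h1 h2
  rw [h1, h2]

lemma integrable_inner_of_memLp {μ : Measure Plane} {G H : Plane → Plane} (hG : MemLp G 2 μ)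
    (hH : MemLp H 2 μ) : Integrable (fun x => inner ℝ (G x) (H x)) μ := by
  refine Integrable.mono' (hG.norm.integrable_mul hH.norm) (hG.1.inner hH.1) (.of_forall fun x => ?_)
  exact norm_inner_le_norm _ _

lemma integrable_norm_sq_of_memLp {μ : Measure Plane} {G : Plane → Plane} (hG : MemLp G 2 μ) :
    Integrable (fun x => ‖G x‖ ^ 2) μ := by
  simpa only [real_inner_self_eq_norm_sq] using integrable_inner_of_memLp hG hG

lemma MemX.bilin_add_left (hΩ : IsOpen Ω) (hb : Bornology.IsBounded Ω) {z : Plane → ℝ}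
    (hv : T.MemX v) (hw : T.MemX w) (hz : T.MemX z) :
    bilin Ω (fun x => v x + w x) z = bilin Ω v z + bilin Ω w z := by
  rw [(hv.add hw).bilin_eq hΩ hb hz, hv.bilin_eq hΩ hb hz, hw.bilin_eq hΩ hb hz, ← integral_add]
  · refine integral_congr_ae ?_
    filter_upwards [hv.ae_differentiableAt hΩ, hw.ae_differentiableAt hΩ] with x h1 h2
    rw [gradient_fun_add h1 h2, inner_add_left]
  · exact integrable_inner_of_memLp (hv.memLp_gradient hΩ hb 2) (hz.memLp_gradient hΩ hb 2)
  · exact integrable_inner_of_memLp (hw.memLp_gradient hΩ hb 2) (hz.memLp_gradient hΩ hb 2)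

lemma MemX.bilin_const_mul_left (hΩ : IsOpen Ω) (hb : Bornology.IsBounded Ω) {z : Plane → ℝ}
    (hv : T.MemX v) (hz : T.MemX z) (c : ℝ) :
    bilin Ω (fun x => c * v x) z = c * bilin Ω v z := by
  rw [(hv.const_mul c).bilin_eq hΩ hb hz, hv.bilin_eq hΩ hb hz, ← integral_const_mul]
  refine integral_congr_ae ?_
  filter_upwards [hv.ae_differentiableAt hΩ] with x h1
  rw [gradient_fun_const_mul h1, real_inner_smul_left]

lemma bilin_comm (Ω : Set Plane) (v w : Plane → ℝ) : bilin Ω v w = bilin Ω w v := by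
  simp only [bilin, real_inner_comm]

lemma MemX.integrable_mul (hΩ : IsOpen Ω) (hb : Bornology.IsBounded Ω) (hv : T.MemX v)
    (hf : MemLp f 2 (volume.restrict Ω)) :
    Integrable (fun x => f x * v x) (volume.restrict Ω) :=
  hf.integrable_mul (hv.memLp hΩ hb 2)

variable (T) in
/-- The space `V_h`, its elements being extended by zero outside `closure Ω`. -/
def testSpace (hΩ : IsOpen Ω) (hb : Bornology.IsBounded Ω) : Submodule ℝ (Plane → ℝ) where
  -- Values off `closure Ω` are unconstrained in `MemV`; fixing them to be zero makes the space
  -- finite dimensional.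
  carrier := {v | T.MemV v ∧ ∀ x ∉ closure Ω, v x = 0}
  add_mem' {v w} hv hw := ⟨⟨hv.1.1.add hw.1.1, hv.1.2.add hΩ hw.1.2⟩, fun x hx => by
    simp [hv.2 x hx, hw.2 x hx]⟩
  zero_mem' := by
    obtain ⟨v, hv, -⟩ := T.exists_memX 0
    have h0 : T.MemX (0 : Plane → ℝ) := by
      have := hv.const_mul 0
      simp only [zero_mul] at this
      exact this
    exact ⟨⟨h0, h0.memH10 hΩ hb fun _ _ => rfl⟩, fun _ _ => rfl⟩
  smul_mem' c v hv := ⟨⟨hv.1.1.const_mul c, hv.1.2.const_mul hΩ c⟩, fun x hx => by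
    simp [hv.2 x hx]⟩

lemma MemX.eqOn_of_eqOn_verts (hv : T.MemX v) (hw : T.MemX w)
    (h : ∀ K ∈ T.elements, ∀ P ∈ K.verts, v P = w P) : Set.EqOn v w (closure Ω) := by
  intro x hx
  obtain ⟨K, hK, hxK⟩ := T.exists_mem_carrier hx
  obtain ⟨l, hl⟩ := hv.2 K hK
  obtain ⟨m, hm⟩ := hw.2 K hK
  rw [hl hxK, hm hxK]
  refine eqOn_convexHull_of_eqOn (fun P hP => ?_) hxK
  rw [← hl (K.verts_subset_carrier hP), ← hm (K.verts_subset_carrier hP), h K hK P hP]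

instance finiteDimensional_testSpace (hΩ : IsOpen Ω) (hb : Bornology.IsBounded Ω) :
    FiniteDimensional ℝ (T.testSpace hΩ hb) := by
  let S : Set Plane := ⋃ K ∈ T.elements, K.verts
  have hS : S.Finite := T.elements.finite_toSet.biUnion fun K _ => K.finite_verts
  have : Finite S := hS
  let Φ : T.testSpace hΩ hb →ₗ[ℝ] (S → ℝ) :=
    (LinearMap.funLeft ℝ ℝ (Subtype.val : S → Plane)).comp (T.testSpace hΩ hb).subtype
  refine Module.Finite.of_injective Φ fun v w hvw => ?_
  have hval : ∀ P ∈ S, v.1 P = w.1 P := fun P hP => congrFun hvw ⟨P, hP⟩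
  ext x
  by_cases hx : x ∈ closure Ω
  · refine v.2.1.1.eqOn_of_eqOn_verts w.2.1.1 (fun K hK P hP => hval P ?_) hx
    exact Set.mem_biUnion (t := fun K : Triangle => K.verts) hK hP
  · rw [v.2.2 x hx, w.2.2 x hx]

/-- The finite element solution exists. -/
lemma exists_isFEMSolution (hΩ : IsOpen Ω) (hb : Bornology.IsBounded Ω)
    (hf : MemLp f 2 (volume.restrict Ω)) (hg : T.MemX g) : ∃ U, T.IsFEMSolution f g U := by
  let V := T.testSpace hΩ hb
  have hX : ∀ v : V, T.MemX v.1 := fun v => v.2.1.1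
  let a : V →ₗ[ℝ] V →ₗ[ℝ] ℝ := LinearMap.mk₂ ℝ (fun v w => bilin Ω v.1 w.1)
    (fun v w z => (hX v).bilin_add_left hΩ hb (hX w) (hX z))
    (fun c v z => (hX v).bilin_const_mul_left hΩ hb (hX z) c)
    (fun z v w => by
      rw [bilin_comm Ω z.1, bilin_comm Ω z.1, bilin_comm Ω z.1]
      exact (hX v).bilin_add_left hΩ hb (hX w) (hX z))
    (fun c z v => by
      rw [bilin_comm Ω z.1, bilin_comm Ω z.1]
      exact (hX v).bilin_const_mul_left hΩ hb (hX z) c)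
  have ha : ∀ v w : V, a v w = bilin Ω v.1 w.1 := fun v w => rfl
  -- Testing with `v` itself makes its gradient vanish a.e.; Friedrichs and continuity then give `v
  -- = 0`.
  have hinj : Function.Injective a := by
    rw [injective_iff_map_eq_zero]
    intro v hv0
    have h1 : ∫ x in Ω, ‖gradient v.1 x‖ ^ 2 = 0 := by
      have := LinearMap.congr_fun hv0 v
      rw [ha, (hX v).bilin_eq hΩ hb (hX v)] at this
      simpa [real_inner_self_eq_norm_sq] using this
    rw [integral_eq_zero_iff_of_nonneg (fun x => by positivity)
      (integrable_norm_sq_of_memLp ((hX v).memLp_gradient hΩ hb 2))] at h1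
    have h2 : weakGrad Ω v.1 =ᵐ[volume.restrict Ω] 0 := by
      filter_upwards [h1, (hX v).weakGrad_ae_eq hΩ hb] with x hx hx'
      rw [hx']
      simpa using hx
    have h3 := v.2.1.2.ae_eq_zero hb h2
    have h4 : Set.EqOn v.1 0 Ω :=
      Measure.eqOn_open_of_ae_eq h3 hΩ ((hX v).1.mono subset_closure) continuousOn_const
    have h5 : Set.EqOn v.1 0 (closure Ω) :=
      h4.of_subset_closure (hX v).1 continuousOn_const subset_closure subset_rfl
    ext x
    by_cases hx : x ∈ closure Ω
    · exact h5 hx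
    · exact v.2.2 x hx
  -- The space and its dual have equal finite dimension, so uniqueness implies existence.
  have hsurj : Function.Surjective a :=
    (LinearMap.injective_iff_surjective_of_finrank_eq_finrank
      (Subspace.dual_finrank_eq (K := ℝ) (V := V)).symm).1 hinj
  let F : V →ₗ[ℝ] ℝ :=
    { toFun := fun v => (∫ x in Ω, f x * v.1 x) - bilin Ω g v.1
      map_add' := fun v w => by
        have e1 : bilin Ω g (v + w : V).1 = bilin Ω g v.1 + bilin Ω g w.1 := by
          rw [bilin_comm Ω g, bilin_comm Ω g, bilin_comm Ω g]
          exact (hX v).bilin_add_left hΩ hb (hX w) hg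
        have e2 : ∫ x in Ω, f x * (v + w : V).1 x =
            (∫ x in Ω, f x * v.1 x) + ∫ x in Ω, f x * w.1 x := by
          rw [← integral_add ((hX v).integrable_mul hΩ hb hf) ((hX w).integrable_mul hΩ hb hf)]
          refine integral_congr_ae (.of_forall fun x => ?_)
          simp [mul_add]
        rw [e1, e2]
        ring
      map_smul' := fun c v => by
        have e1 : bilin Ω g (c • v : V).1 = c * bilin Ω g v.1 := by
          rw [bilin_comm Ω g, bilin_comm Ω g]
          exact (hX v).bilin_const_mul_left hΩ hb hg c
        have e2 : ∫ x in Ω, f x * (c • v : V).1 x = c * ∫ x in Ω, f x * v.1 x := by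
          rw [← integral_const_mul]
          refine integral_congr_ae (.of_forall fun x => ?_)
          simp
          ring
        rw [e1, e2]
        simp
        ring }
  obtain ⟨z, hz⟩ := hsurj F
  refine ⟨fun x => g x + z.1 x, hg.add (hX z), ?_, fun v hv => ?_⟩
  · simpa using z.2.1
  -- A general test function is replaced by its zero extension, which changes neither side of the
  -- equation.
  · let v' : Plane → ℝ := (closure Ω).indicator v
    have hvv : Set.EqOn v' v (closure Ω) := fun x hx => Set.indicator_of_mem hx v
    have hvΩ : Set.EqOn v v' Ω := fun x hx => (hvv (subset_closure hx)).symm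
    have hv' : v' ∈ V :=
      ⟨⟨hv.1.congr hvv, hv.2.congr hΩ hvΩ⟩, fun x hx => Set.indicator_of_notMem hx v⟩
    have e1 : bilin Ω (fun x => g x + z.1 x) v = bilin Ω (fun x => g x + z.1 x) v' := by
      refine integral_congr_ae ?_
      filter_upwards [weakGrad_congr hΩ hv.2.1 hvΩ] with x hx
      rw [hx]
    have e2 : ∫ x in Ω, f x * v x = ∫ x in Ω, f x * v' x :=
      setIntegral_congr_fun hΩ.measurableSet fun x hx => by simp only [hvΩ hx]
    have e3 := LinearMap.congr_fun hz ⟨v', hv'⟩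
    rw [ha] at e3
    rw [e1, e2, hg.bilin_add_left hΩ hb (hX z) (hX ⟨v', hv'⟩), e3]
    simp [F]

/-- Céa's lemma for the energy seminorm. -/
lemma IsFEMSolution.h1Seminorm_sub_le (hΩ : IsOpen Ω) (hb : Bornology.IsBounded Ω)
    {u U : Plane → ℝ} {G : Plane → Plane} (huf : IsWeakSolution Ω f u) (hG : IsWeakGrad Ω u G)
    (hG2 : MemLp G 2 (volume.restrict Ω)) (hU : T.IsFEMSolution f g U) (hw : T.MemX w)
    (hUw : T.MemV (fun x => U x - w x)) :
    MemH1 Ω (fun x => u x - U x) ∧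
      h1Seminorm Ω (fun x => u x - U x) ≤ √(∫ x in Ω, ‖G x - gradient w x‖ ^ 2) := by
  refine ⟨huf.1.sub (hU.1.memH1 hΩ hb), Real.sqrt_le_sqrt ?_⟩
  have hgU := hU.1.memLp_gradient hΩ hb 2
  have hgw := hw.memLp_gradient hΩ hb 2
  have e0 : ∫ x in Ω, ‖weakGrad Ω (fun x => u x - U x) x‖ ^ 2 =
      ∫ x in Ω, ‖G x - gradient U x‖ ^ 2 := by
    refine integral_congr_ae ?_
    filter_upwards [(hG.sub (hU.1.isWeakGrad hΩ hb)).weakGrad_ae_eq hΩ] with x hx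
    rw [hx]
  -- Galerkin orthogonality: `U - w` is an admissible test function in both the continuous and the
  -- discrete equation.
  have horth : ∫ x in Ω, inner ℝ (G x - gradient U x) (gradient U x - gradient w x) = 0 := by
    have e1 := huf.2 _ hUw.2
    have e2 := hU.2.2 _ hUw
    have hd := ((hU.1.isWeakGrad hΩ hb).sub (hw.isWeakGrad hΩ hb)).weakGrad_ae_eq hΩ
    have e3 : bilin Ω u (fun x => U x - w x) =
        ∫ x in Ω, inner ℝ (G x) (gradient U x - gradient w x) := by
      refine integral_congr_ae ?_
      filter_upwards [hG.weakGrad_ae_eq hΩ, hd] with x h1 h2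
      rw [h1, h2]
    have e4 : bilin Ω U (fun x => U x - w x) =
        ∫ x in Ω, inner ℝ (gradient U x) (gradient U x - gradient w x) := by
      refine integral_congr_ae ?_
      filter_upwards [hU.1.weakGrad_ae_eq hΩ hb, hd] with x h1 h2
      rw [h1, h2]
    simp only [inner_sub_left (G _)]
    have i1 := integrable_inner_of_memLp hG2 (hgU.sub hgw)
    have i2 := integrable_inner_of_memLp hgU (hgU.sub hgw)
    simp only [Pi.sub_apply] at i1 i2
    rw [integral_sub i1 i2, ← e3, ← e4, e1, e2, sub_self]
  rw [e0]
  -- Expand the square and drop `‖∇U - ∇w‖²`; the cross term integrates to zero.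
  have hpt : ∀ x, ‖G x - gradient U x‖ ^ 2 +
      2 * inner ℝ (G x - gradient U x) (gradient U x - gradient w x) ≤
      ‖G x - gradient w x‖ ^ 2 := fun x => by
    have h1 : G x - gradient w x = (G x - gradient U x) + (gradient U x - gradient w x) := by abel
    rw [h1, norm_add_sq_real]
    nlinarith [sq_nonneg ‖gradient U x - gradient w x‖]
  have i1 : Integrable (fun x => ‖G x - gradient U x‖ ^ 2) (volume.restrict Ω) :=
    integrable_norm_sq_of_memLp (hG2.sub hgU)
  have i2 : Integrable (fun x => ‖G x - gradient w x‖ ^ 2) (volume.restrict Ω) :=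
    integrable_norm_sq_of_memLp (hG2.sub hgw)
  have i3 := (integrable_inner_of_memLp (hG2.sub hgU) (hgU.sub hgw)).const_mul 2
  have := integral_mono (i1.add i3) i2 hpt
  rw [integral_add' i1 i3, integral_const_mul] at this
  simp only [Pi.sub_apply] at this
  rw [horth] at this
  linarith

end Triangulation

/-! ### Gradient bounds from difference quotients -/

/-- In the plane a vector is determined by its inner products with two independent vectors, with a
loss of `1 / sin` of the angle between them. -/
lemma norm_mul_sin_angle_le {z a b : Plane} {m : ℝ} (ha : a ≠ 0) (hb : b ≠ 0)
    (hza : |inner ℝ z a| ≤ m * ‖a‖) (hzb : |inner ℝ z b| ≤ m * ‖b‖) :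
    ‖z‖ * Real.sin (InnerProductGeometry.angle a b) ≤ 2 * m := by
  have hna : 0 < ‖a‖ := norm_pos_iff.2 ha
  have hnb : 0 < ‖b‖ := norm_pos_iff.2 hb
  have hm : 0 ≤ m := nonneg_of_mul_nonneg_left ((abs_nonneg _).trans hza) hna
  have hsin := InnerProductGeometry.sin_angle_mul_norm_mul_norm a b
  have hs0 : 0 ≤ Real.sin (InnerProductGeometry.angle a b) :=
    InnerProductGeometry.sin_angle_nonneg a b
  set S := Real.sin (InnerProductGeometry.angle a b)
  have hnn : 0 ≤ inner ℝ a a * inner ℝ b b - inner ℝ a b * inner ℝ a b := by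
    have := real_inner_mul_inner_self_le a b
    linarith
  have hS2 : S ^ 2 * (‖a‖ ^ 2 * ‖b‖ ^ 2) = ‖a‖ ^ 2 * ‖b‖ ^ 2 - (inner ℝ a b) ^ 2 := by
    have : (S * (‖a‖ * ‖b‖)) ^ 2 = inner ℝ a a * inner ℝ b b - inner ℝ a b * inner ℝ a b := by
      rw [hsin, Real.sq_sqrt hnn]
    rw [real_inner_self_eq_norm_sq, real_inner_self_eq_norm_sq] at this
    linarith
  -- The Gram determinant of `z, a, b` vanishes because the dimension is two. Bounding the three
  -- terms on the right gives weights `1 + 2 + 1`, hence `(2m)²`.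
  have hid : (‖a‖ ^ 2 * ‖b‖ ^ 2 - (inner ℝ a b) ^ 2) * ‖z‖ ^ 2 =
      (inner ℝ z a) ^ 2 * ‖b‖ ^ 2 - 2 * inner ℝ z a * inner ℝ z b * inner ℝ a b +
        (inner ℝ z b) ^ 2 * ‖a‖ ^ 2 := by
    simp only [← real_inner_self_eq_norm_sq, PiLp.inner_apply, Fin.sum_univ_two]
    simp
    ring
  have hab : |inner ℝ a b| ≤ ‖a‖ * ‖b‖ := abs_real_inner_le_norm a b
  have h1 : (inner ℝ z a) ^ 2 ≤ (m * ‖a‖) ^ 2 := sq_le_sq.2 (hza.trans (le_abs_self _))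
  have h2 : (inner ℝ z b) ^ 2 ≤ (m * ‖b‖) ^ 2 := sq_le_sq.2 (hzb.trans (le_abs_self _))
  have h3 : |inner ℝ z a * inner ℝ z b * inner ℝ a b| ≤ (m * ‖a‖) * (m * ‖b‖) * (‖a‖ * ‖b‖) := by
    rw [abs_mul, abs_mul]
    gcongr
  have h4 : (‖z‖ * S) ^ 2 * (‖a‖ ^ 2 * ‖b‖ ^ 2) ≤ (2 * m) ^ 2 * (‖a‖ ^ 2 * ‖b‖ ^ 2) := by
    have e1 : (‖z‖ * S) ^ 2 * (‖a‖ ^ 2 * ‖b‖ ^ 2) =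
        (‖a‖ ^ 2 * ‖b‖ ^ 2 - (inner ℝ a b) ^ 2) * ‖z‖ ^ 2 := by
      rw [← hS2]; ring
    rw [e1, hid]
    have h5 := mul_le_mul_of_nonneg_right h1 (sq_nonneg ‖b‖)
    have h6 := mul_le_mul_of_nonneg_right h2 (sq_nonneg ‖a‖)
    have h7 := neg_abs_le (inner ℝ z a * inner ℝ z b * inner ℝ a b)
    linarith
  exact le_of_sq_le_sq (le_of_mul_le_mul_right h4 (by positivity)) (by positivity)

/-- The sine increases up to `π/2` and decreases afterwards, so its minimum on `[π/3, α₀]` is at an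
endpoint. -/
lemma exists_pos_le_sin {α₀ : ℝ} (hα : α₀ < Real.pi) :
    ∃ κ > 0, ∀ θ, Real.pi / 3 ≤ θ → θ ≤ α₀ → κ ≤ Real.sin θ := by
  have hpi := Real.pi_pos
  by_cases h : Real.pi / 3 ≤ α₀
  · refine ⟨min (Real.sin (Real.pi / 3)) (Real.sin α₀), lt_min ?_ ?_, fun θ h1 h2 => ?_⟩
    · exact Real.sin_pos_of_pos_of_lt_pi (by positivity) (by linarith)
    · exact Real.sin_pos_of_pos_of_lt_pi (by linarith) hα
    · rcases le_total θ (Real.pi / 2) with h3 | h3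
      · exact (min_le_left _ _).trans
          (Real.sin_le_sin_of_le_of_le_pi_div_two (by linarith) h3 h1)
      · refine (min_le_right _ _).trans ?_
        rw [← Real.sin_pi_sub α₀, ← Real.sin_pi_sub θ]
        exact Real.sin_le_sin_of_le_of_le_pi_div_two (by linarith) (by linarith) (by linarith)
  · exact ⟨1, one_pos, fun θ h1 h2 => absurd (h1.trans h2) h⟩

namespace Triangle

variable (K : Triangle)

lemma pi_div_three_le_maxAngle : Real.pi / 3 ≤ K.maxAngle := by
  have h := EuclideanGeometry.angle_add_angle_add_angle_eq_pi K.C K.A_ne_B.symm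
  have h1 := K.angle_B_le
  have h2 := K.angle_C_le
  rw [EuclideanGeometry.angle_comm K.B K.C K.A, EuclideanGeometry.angle_comm K.C K.A K.B] at h
  unfold maxAngle
  linarith

/-- The edges at `A` enclose the maximum angle, which is at least `π/3`; only its closeness to `π`
can make the sine small. -/
lemma norm_affineGrad_sub_le {κ : ℝ} (hκ : 0 < κ) (hK : κ ≤ Real.sin K.maxAngle)
    {l : Plane →ᵃ[ℝ] ℝ} {q : Plane} {m : ℝ}
    (hB : |l K.B - l K.A - inner ℝ q (K.B - K.A)| ≤ m * dist K.B K.A)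
    (hC : |l K.C - l K.A - inner ℝ q (K.C - K.A)| ≤ m * dist K.C K.A) :
    ‖affineGrad l - q‖ ≤ 2 * m / κ := by
  rw [← inner_affineGrad, ← inner_sub_left, dist_eq_norm] at hB hC
  have h := norm_mul_sin_angle_le (sub_ne_zero.2 K.A_ne_B.symm) (sub_ne_zero.2 K.A_ne_C.symm) hB hC
  rw [le_div_iff₀ hκ]
  exact (mul_le_mul_of_nonneg_left hK (norm_nonneg _)).trans h

lemma affineGrad_eq_of_eqOn {l m : Plane →ᵃ[ℝ] ℝ} (h : Set.EqOn l m K.verts) :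
    affineGrad l = affineGrad m := by
  obtain ⟨x, hx⟩ := K.interior_nonempty
  have h' : Set.EqOn l m K.carrier := eqOn_convexHull_of_eqOn h
  exact (hasGradientAt_affine l x).unique (Triangulation.hasGradientAt_of_eqOn h' hx)

/-- Perturbing the value at the vertex `A` makes the gradient of the affine interpolant accurate
regardless of the shape of the triangle. -/
lemma exists_perturbation {u : Plane → ℝ} {q : Plane} {m : ℝ}
    (hu : ∀ x ∈ K.carrier, ∀ y ∈ K.carrier, |u x - u y - inner ℝ q (x - y)| ≤ m * dist x y) :
    ∃ δ : ℝ, |δ| ≤ 4 * m * K.radius ∧ ∀ l : Plane →ᵃ[ℝ] ℝ,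
      l K.A = u K.A + δ → l K.B = u K.B → l K.C = u K.C → ‖affineGrad l - q‖ ≤ m := by
  have hA := K.verts_subset_carrier K.A_mem_verts
  have hB := K.verts_subset_carrier K.B_mem_verts
  have hC := K.verts_subset_carrier K.C_mem_verts
  have hn : 0 < ‖K.C - K.B‖ := norm_pos_iff.2 (sub_ne_zero.2 K.B_ne_C.symm)
  -- The slope `q` is corrected along the edge `BC` alone, so that `p` reproduces `u K.C - u K.B`
  -- exactly. The estimate along that edge bounds the correction by `m`.
  set c : ℝ := (u K.C - u K.B - inner ℝ q (K.C - K.B)) / ‖K.C - K.B‖ ^ 2 with hc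
  have hcm : |c| * ‖K.C - K.B‖ ≤ m := by
    rw [hc, abs_div, abs_of_nonneg (sq_nonneg ‖K.C - K.B‖), div_mul_eq_mul_div,
      div_le_iff₀ (by positivity)]
    have := hu _ hC _ hB
    rw [dist_eq_norm] at this
    nlinarith
  set p : Plane := q + c • (K.C - K.B) with hp
  have hpBC : inner ℝ p (K.C - K.B) = u K.C - u K.B := by
    rw [hp, inner_add_left, real_inner_smul_left, real_inner_self_eq_norm_sq, hc,
      div_mul_cancel₀ _ (by positivity)]
    ring
  have hcv : ∀ z, |c * inner ℝ (K.C - K.B) z| ≤ m * ‖z‖ := fun z => by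
    rw [abs_mul]
    calc |c| * |inner ℝ (K.C - K.B) z| ≤ |c| * (‖K.C - K.B‖ * ‖z‖) :=
          mul_le_mul_of_nonneg_left (abs_real_inner_le_norm _ _) (abs_nonneg _)
      _ = |c| * ‖K.C - K.B‖ * ‖z‖ := by ring
      _ ≤ m * ‖z‖ := mul_le_mul_of_nonneg_right hcm (norm_nonneg _)
  have hbound : ∀ Q ∈ K.carrier, |u Q + inner ℝ p (K.A - Q) - u K.A| ≤ 2 * m * dist K.A Q := by
    intro Q hQ
    have h1 := hu _ hA _ hQ
    have h2 := hcv (K.A - Q)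
    rw [← dist_eq_norm] at h2
    rw [hp, inner_add_left, real_inner_smul_left]
    rw [abs_le] at *
    constructor <;> linarith
  -- This moves the value at `A` onto the affine function of slope `p` through the data at `B` and
  -- `C`. Computing from `C` gives the same `δ`, so the nearer vertex can be used: `2m` times twice
  -- the radius gives `4 m r_K`.
  set δ : ℝ := u K.B + inner ℝ p (K.A - K.B) - u K.A with hδ
  have hδC : δ = u K.C + inner ℝ p (K.A - K.C) - u K.A := by
    have : K.A - K.B = (K.A - K.C) + (K.C - K.B) := by abel
    rw [hδ, this, inner_add_right, hpBC]
    ring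
  refine ⟨δ, ?_, fun l h1 h2 h3 => ?_⟩
  · have b1 := hbound _ hB
    have b2 := hbound _ hC
    rw [← hδ] at b1
    rw [← hδC] at b2
    unfold radius
    rcases min_choice (dist K.A K.B) (dist K.A K.C) with h | h <;> rw [h] <;> linarith
  · let l₀ : Plane →ᵃ[ℝ] ℝ := (innerSL ℝ p).toLinearMap.toAffineMap +
      AffineMap.const ℝ Plane (u K.B - inner ℝ p K.B)
    have hl₀ : ∀ x, l₀ x = inner ℝ p x + (u K.B - inner ℝ p K.B) := fun x => by simp [l₀]
    have hgrad : affineGrad l₀ = p := by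
      refine ext_inner_right ℝ fun x => ?_
      have := inner_affineGrad l₀ x 0
      rw [sub_zero, hl₀, hl₀, inner_zero_right] at this
      linarith
    have heq : Set.EqOn l l₀ K.verts := by
      intro P hP
      rw [hl₀]
      simp only [verts, Set.mem_insert_iff, Set.mem_singleton_iff] at hP
      rcases hP with rfl | rfl | rfl
      · rw [h1, hδ, inner_sub_right]; ring
      · rw [h2]; ring
      · rw [h3]
        rw [inner_sub_right] at hpBC
        linarith
    rw [K.affineGrad_eq_of_eqOn heq, hgrad, hp, add_sub_cancel_left, norm_smul, Real.norm_eq_abs]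
    exact hcm

/-- The tent function on the disk of radius `r_K` around `A_K`. -/
noncomputable def tent (x : Plane) : ℝ := max 0 (1 - dist x K.A / K.radius)

lemma tent_nonneg (x : Plane) : 0 ≤ K.tent x := le_max_left _ _

lemma tent_le_one (x : Plane) : K.tent x ≤ 1 := by
  have : 0 ≤ dist x K.A / K.radius := div_nonneg dist_nonneg K.radius_pos.le
  exact max_le zero_le_one (by linarith)

lemma tent_A : K.tent K.A = 1 := by simp [tent]

lemma tent_eq_zero {x : Plane} (h : K.radius ≤ dist x K.A) : K.tent x = 0 := by
  have : 1 ≤ dist x K.A / K.radius := by rwa [one_le_div K.radius_pos]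
  exact max_eq_left (by linarith)

lemma abs_tent_sub_le (x y : Plane) : |K.tent x - K.tent y| ≤ dist x y / K.radius := by
  have h1 := abs_max_sub_max_le_abs (1 - dist x K.A / K.radius) (1 - dist y K.A / K.radius) 0
  unfold tent
  rw [max_comm 0, max_comm 0]
  refine h1.trans ?_
  have : 1 - dist x K.A / K.radius - (1 - dist y K.A / K.radius) =
      (dist y K.A - dist x K.A) / K.radius := by ring
  rw [this, abs_div, abs_of_pos K.radius_pos]
  refine div_le_div_of_nonneg_right ?_ K.radius_pos.le
  rw [dist_comm x y]
  exact abs_dist_sub_le y x K.A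

end Triangle

/-! ### The modified interpolant and its error. -/

namespace Triangulation

variable {T : Triangulation Ω} {T₂ : Finset Triangle} {C₀ : ℝ}

lemma Separated.eq_of_dist_lt (hS : Separated T₂ C₀) {P : Plane} {K K' : Triangle}
    (hK : K ∈ T₂) (hK' : K' ∈ T₂) (h : dist P K.A < K.radius) (h' : dist P K'.A < K'.radius) :
    K = K' := by
  by_contra hne
  have h1 := hS.dist_A K hK K' hK' hne
  have h2 := dist_triangle_left K.A K'.A P
  linarith

lemma Separated.sum_mul_tent_eq (hS : Separated T₂ C₀) (δ : Triangle → ℝ) {P : Plane}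
    {K : Triangle} (hK : K ∈ T₂) (h : dist P K.A < K.radius) :
    ∑ K' ∈ T₂, δ K' * K'.tent P = δ K * K.tent P := by
  refine Finset.sum_eq_single_of_mem K hK fun K' hK' hne => ?_
  rw [K'.tent_eq_zero, mul_zero]
  by_contra! hcon
  exact hne (hS.eq_of_dist_lt hK' hK hcon h)

lemma sum_mul_tent_eq_zero (δ : Triangle → ℝ) {P : Plane}
    (h : ∀ K ∈ T₂, K.radius ≤ dist P K.A) : ∑ K ∈ T₂, δ K * K.tent P = 0 :=
  Finset.sum_eq_zero fun K hK => by rw [K.tent_eq_zero (h K hK), mul_zero]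

open Classical in
/-- The elements of `T₂` whose disk contains a vertex of `K`. -/
noncomputable def touching (T₂ : Finset Triangle) (K : Triangle) : Finset Triangle :=
  T₂.filter fun K' => ∃ P ∈ K.verts, dist P K'.A < K'.radius

/-- The disks are disjoint, so each of the three vertices lies in at most one. -/
lemma Separated.card_touching_le (hS : Separated T₂ C₀) (K : Triangle) :
    (touching T₂ K).card ≤ 3 := by
  classical
  let N : Plane → Finset Triangle := fun P => T₂.filter fun K' => dist P K'.A < K'.radius
  have hN : ∀ P, (N P).card ≤ 1 := fun P => Finset.card_le_one.2 fun K₁ h₁ K₂ h₂ => by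
    rw [Finset.mem_filter] at h₁ h₂
    exact hS.eq_of_dist_lt h₁.1 h₂.1 h₁.2 h₂.2
  have hsub : touching T₂ K ⊆ N K.A ∪ (N K.B ∪ N K.C) := by
    intro K' hK'
    simp only [touching, Finset.mem_filter, Triangle.verts, Set.mem_insert_iff,
      Set.mem_singleton_iff] at hK'
    obtain ⟨h1, P, rfl | rfl | rfl, h2⟩ := hK'
    all_goals simp [N, h1, h2]
  have h1 := Finset.card_le_card hsub
  have h2 := Finset.card_union_le (N K.A) (N K.B ∪ N K.C)
  have h3 := Finset.card_union_le (N K.B) (N K.C)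
  linarith [hN K.A, hN K.B, hN K.C]

/-- The factor `r_{K'}` in the shift cancels the slope `1 / r_{K'}` of the tent, leaving `4 L
h_{K'}` however small the disk is. -/
lemma abs_sum_mul_tent_sub_le {δ : Triangle → ℝ} {L : ℝ}
    (hδ : ∀ K ∈ T₂, |δ K| ≤ 4 * (L * K.diam) * K.radius) {K : Triangle} {P Q : Plane}
    (hP : P ∈ K.verts) (hQ : Q ∈ K.verts) :
    |∑ K' ∈ T₂, δ K' * K'.tent P - ∑ K' ∈ T₂, δ K' * K'.tent Q| ≤
      (∑ K' ∈ touching T₂ K, 4 * L * K'.diam) * dist P Q := by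
  classical
  rw [← Finset.sum_sub_distrib, touching, Finset.sum_mul, Finset.sum_filter]
  refine (Finset.abs_sum_le_sum_abs _ _).trans (Finset.sum_le_sum fun K' hK' => ?_)
  split_ifs with h
  · rw [← mul_sub, abs_mul]
    have hr := K'.radius_pos
    calc |δ K'| * |K'.tent P - K'.tent Q|
        ≤ (4 * (L * K'.diam) * K'.radius) * (dist P Q / K'.radius) :=
          mul_le_mul (hδ K' hK') (K'.abs_tent_sub_le P Q) (abs_nonneg _)
            ((abs_nonneg _).trans (hδ K' hK'))
      _ = 4 * L * K'.diam * dist P Q := by field_simp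
  · push Not at h
    rw [K'.tent_eq_zero (h P hP), K'.tent_eq_zero (h Q hQ)]
    simp

/-- Any point of a touched element is within `h + h/2` of the centre of the disk. Passing to
indicators of balls avoids counting the elements a disk touches. -/
lemma sum_touching_le (hT : T₂ ⊆ T.elements) {K : Triangle} (hK : K ∈ T.elements) {x : Plane}
    (hx : x ∈ K.carrier) :
    ∑ K' ∈ touching T₂ K, K'.diam ^ 2 ≤
      ∑ K' ∈ T₂, (Metric.closedBall K'.A (2 * T.meshSize)).indicator (fun _ => K'.diam ^ 2) x := by
  classical
  rw [touching, Finset.sum_filter]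
  refine Finset.sum_le_sum fun K' hK' => ?_
  split_ifs with h
  · obtain ⟨P, hP, hPA⟩ := h
    rw [Set.indicator_of_mem]
    rw [Metric.mem_closedBall]
    have h1 := K.dist_le_diam hx (K.verts_subset_carrier hP)
    have h2 := T.diam_le_meshSize hK
    have h3 := T.diam_le_meshSize (hT hK')
    have h4 := K'.radius_le_diam
    have h5 := K'.diam_nonneg
    have h6 := dist_triangle x P K'.A
    linarith
  · exact Set.indicator_nonneg (fun _ _ => sq_nonneg _) _

/-- Cauchy–Schwarz with at most three terms; `48 = 3 · 4²`. -/
lemma Separated.sq_sum_touching_le (hS : Separated T₂ C₀) (L : ℝ) (K : Triangle) :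
    (∑ K' ∈ touching T₂ K, 4 * L * K'.diam) ^ 2 ≤
      48 * L ^ 2 * ∑ K' ∈ touching T₂ K, K'.diam ^ 2 := by
  have h0 : 0 ≤ ∑ K' ∈ touching T₂ K, K'.diam ^ 2 := Finset.sum_nonneg fun _ _ => sq_nonneg _
  have h1 := sq_sum_le_card_mul_sum_sq (s := touching T₂ K) (f := fun K' => K'.diam)
  have h2 : ((touching T₂ K).card : ℝ) ≤ 3 := by exact_mod_cast hS.card_touching_le K
  rw [← Finset.mul_sum, mul_pow]
  have h3 := mul_le_mul_of_nonneg_right h2 h0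
  have h4 := mul_le_mul_of_nonneg_left (h1.trans h3) (sq_nonneg (4 * L))
  linarith

lemma sq_le_of_le_add_div {L h D κ S y : ℝ} (hy : 0 ≤ y)
    (h1 : y ≤ L * h + 2 * (L * h + D) / κ) (hD : D ^ 2 ≤ 48 * L ^ 2 * S) :
    y ^ 2 ≤ (4 * L ^ 2 + 16 * L ^ 2 / κ ^ 2) * h ^ 2 + 768 * L ^ 2 / κ ^ 2 * S := by
  have h2 : (L * h + D) ^ 2 ≤ 2 * (L * h) ^ 2 + 2 * (48 * L ^ 2 * S) := by
    nlinarith [sq_nonneg (L * h - D)]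
  have h3 := div_le_div_of_nonneg_right h2 (sq_nonneg κ)
  calc y ^ 2 ≤ (L * h + 2 * (L * h + D) / κ) ^ 2 := pow_le_pow_left₀ hy h1 2
    _ ≤ 2 * (L * h) ^ 2 + 2 * (2 * (L * h + D) / κ) ^ 2 := by
        linarith [sq_nonneg (L * h - 2 * (L * h + D) / κ)]
    _ = 2 * (L * h) ^ 2 + 8 * ((L * h + D) ^ 2 / κ ^ 2) := by ring
    _ ≤ 2 * (L * h) ^ 2 + 8 * ((2 * (L * h) ^ 2 + 2 * (48 * L ^ 2 * S)) / κ ^ 2) := by linarith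
    _ = (2 * L ^ 2 + 16 * L ^ 2 / κ ^ 2) * h ^ 2 + 768 * L ^ 2 / κ ^ 2 * S := by ring
    _ ≤ _ := by linarith [mul_nonneg (sq_nonneg L) (sq_nonneg h)]

/-- The modified interpolant: a finite element function that interpolates `u` up to a small
perturbation in the disks, and that approximates the gradient of `u`. -/
lemma exists_approx (hΩ : IsOpen Ω) {u : Plane → ℝ} {G : Plane → Plane}
    {L κ : ℝ} (hL : 0 ≤ L) (hκ : 0 < κ) (hT : T₂ ⊆ T.elements)
    (hang : ∀ K ∈ T.elements, K ∉ T₂ → κ ≤ Real.sin K.maxAngle) (hS : Separated T₂ C₀)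
    (hu : ∀ K ∈ T.elements, ∃ q : Plane,
      (∀ᵐ x, x ∈ interior K.carrier → ‖G x - q‖ ≤ L * K.diam) ∧
      ∀ x ∈ K.carrier, ∀ y ∈ K.carrier, |u x - u y - inner ℝ q (x - y)| ≤ L * K.diam * dist x y) :
    ∃ w, T.IsAdaptedDatum T₂ u (2 * L) w ∧ ∀ᵐ x ∂(volume.restrict Ω),
      ‖G x - gradient w x‖ ^ 2 ≤ (4 * L ^ 2 + 16 * L ^ 2 / κ ^ 2) * T.meshSize ^ 2 +
        768 * L ^ 2 / κ ^ 2 * ∑ K ∈ T₂,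
          (Metric.closedBall K.A (2 * T.meshSize)).indicator (fun _ => K.diam ^ 2) x := by
  choose! q hqG hqu using hu
  have hδ : ∀ K ∈ T.elements, ∃ δ : ℝ, |δ| ≤ 4 * (L * K.diam) * K.radius ∧
      ∀ l : Plane →ᵃ[ℝ] ℝ, l K.A = u K.A + δ → l K.B = u K.B → l K.C = u K.C →
        ‖affineGrad l - q K‖ ≤ L * K.diam := fun K hK => K.exists_perturbation (hqu K hK)
  choose! δ hδr hδl using hδ
  -- Only the vertex values of the tents enter; `w` is affine on each element.
  obtain ⟨w, hw, hwv⟩ := T.exists_memX fun x => u x + ∑ K ∈ T₂, δ K * K.tent x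
  refine ⟨w, ⟨hw, ?_, ?_⟩, ?_⟩
  · rintro P ⟨-, K, hK, hP⟩ hfar
    rw [hwv K hK P hP, sum_mul_tent_eq_zero δ hfar, add_zero]
  · rintro P ⟨-, K, hK, hP⟩ K' hK' hnear
    rw [hwv K hK P hP, hS.sum_mul_tent_eq δ hK' hnear, add_sub_cancel_left, abs_mul,
      abs_of_nonneg (K'.tent_nonneg P)]
    have h1 := hδr K' (hT hK')
    have h2 : |δ K'| * K'.tent P ≤ |δ K'| :=
      mul_le_of_le_one_right (abs_nonneg _) (K'.tent_le_one P)
    -- With `r ≤ h_{K'} / 2`, the shift `4 L h_{K'} r` is at most `2 L h_{K'}²`.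
    have h3 := mul_le_mul_of_nonneg_left K'.radius_le_diam
      (show 0 ≤ 4 * (L * K'.diam) from by have := K'.diam_nonneg; positivity)
    nlinarith
  · have hall : ∀ᵐ x, ∀ K ∈ T.elements, x ∈ interior K.carrier → ‖G x - q K‖ ≤ L * K.diam :=
      (T.elements.eventually_all).2 hqG
    filter_upwards [T.ae_exists_mem_interior hΩ, ae_restrict_of_ae hall] with x ⟨K, hK, hx⟩ hG
    obtain ⟨l, hl⟩ := hw.2 K hK
    rw [(hasGradientAt_of_eqOn hl hx).gradient]
    have hlv : ∀ P ∈ K.verts, l P = u P + ∑ K ∈ T₂, δ K * K.tent P := fun P hP => by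
      rw [← hl (K.verts_subset_carrier hP), hwv K hK P hP]
    have hh := T.diam_le_meshSize hK
    have hd := K.diam_nonneg
    set h := T.meshSize
    have hLh : L * K.diam ≤ L * h := mul_le_mul_of_nonneg_left hh hL
    have hGx : ‖G x - q K‖ ≤ L * h := (hG K hK hx).trans hLh
    have hsum := sum_touching_le hT hK (interior_subset hx)
    generalize (∑ K ∈ T₂, (Metric.closedBall K.A (2 * h)).indicator (fun _ => K.diam ^ 2) x) = S
      at hsum ⊢
    have hS0 : 0 ≤ S := (Finset.sum_nonneg fun _ _ => sq_nonneg _).trans hsum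
    have htri : ‖G x - affineGrad l‖ ≤ ‖G x - q K‖ + ‖affineGrad l - q K‖ := by
      have : G x - affineGrad l = (G x - q K) - (affineGrad l - q K) := by abel
      rw [this]
      exact norm_sub_le _ _
    by_cases hK2 : K ∈ T₂
    · have hb : ‖affineGrad l - q K‖ ≤ L * K.diam := by
        refine hδl K hK l ?_ ?_ ?_
        · rw [hlv _ K.A_mem_verts, hS.sum_mul_tent_eq δ hK2 (by simpa using K.radius_pos), K.tent_A,
            mul_one]
        · rw [hlv _ K.B_mem_verts, sum_mul_tent_eq_zero δ, add_zero]
          intro K' hK'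
          rw [dist_comm]
          exact hS.dist_B K' hK' K hK2
        · rw [hlv _ K.C_mem_verts, sum_mul_tent_eq_zero δ, add_zero]
          intro K' hK'
          rw [dist_comm]
          exact hS.dist_C K' hK' K hK2
      have h1 : ‖G x - affineGrad l‖ ≤ 2 * L * h := by linarith
      calc ‖G x - affineGrad l‖ ^ 2 ≤ (2 * L * h) ^ 2 := pow_le_pow_left₀ (norm_nonneg _) h1 2
        _ = 4 * L ^ 2 * h ^ 2 := by ring
        _ ≤ _ := by
          have : 0 ≤ 16 * L ^ 2 / κ ^ 2 * h ^ 2 + 768 * L ^ 2 / κ ^ 2 * S := by positivity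
          linarith
    -- On a good element the tents add at most `D` to the difference quotients along the edges, and
    -- the angle bound turns this into a gradient error.
    · set D := ∑ K' ∈ touching T₂ K, 4 * L * K'.diam with hD
      have hedge : ∀ P ∈ K.verts, |l P - l K.A - inner ℝ (q K) (P - K.A)| ≤
          (L * h + D) * dist P K.A := by
        intro P hP
        rw [hlv P hP, hlv _ K.A_mem_verts]
        have h1 := hqu K hK P (K.verts_subset_carrier hP) K.A
          (K.verts_subset_carrier K.A_mem_verts)
        have h2 := abs_sum_mul_tent_sub_le (fun K' hK' => hδr K' (hT hK')) hP K.A_mem_verts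
        have h3 := mul_le_mul_of_nonneg_right hLh (dist_nonneg (x := P) (y := K.A))
        rw [← hD] at h2
        rw [add_mul]
        rw [abs_le] at *
        constructor <;> linarith
      have hb := K.norm_affineGrad_sub_le hκ (hang K hK hK2) (hedge _ K.B_mem_verts)
        (hedge _ K.C_mem_verts)
      have hD2 : D ^ 2 ≤ 48 * L ^ 2 * S := (hS.sq_sum_touching_le L K).trans
        (mul_le_mul_of_nonneg_left hsum (by positivity))
      have h1 : ‖G x - affineGrad l‖ ≤ L * h + 2 * (L * h + D) / κ := by linarith
      exact sq_le_of_le_add_div (norm_nonneg _) h1 hD2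

lemma integral_indicator_closedBall_le {Ω : Set Plane} (A : Plane) {h c : ℝ} (hh : 0 ≤ h)
    (hc : 0 ≤ c) :
    Integrable ((Metric.closedBall A (2 * h)).indicator (fun _ => c)) (volume.restrict Ω) ∧
    ∫ x in Ω, (Metric.closedBall A (2 * h)).indicator (fun _ => c) x ≤
      4 * h ^ 2 * volume.real (Metric.ball (0 : Plane) 1) * c := by
  have hm : MeasurableSet (Metric.closedBall A (2 * h)) := measurableSet_closedBall
  have hi : Integrable ((Metric.closedBall A (2 * h)).indicator (fun _ => c)) volume := by
    rw [integrable_indicator_iff hm]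
    exact integrableOn_const measure_closedBall_lt_top.ne
  refine ⟨hi.integrableOn, ?_⟩
  have h1 := setIntegral_le_integral hi (s := Ω)
    (.of_forall fun x => Set.indicator_nonneg (fun _ _ => hc) x)
  refine h1.trans (le_of_eq ?_)
  rw [integral_indicator hm, setIntegral_const, smul_eq_mul, measureReal_def,
    Measure.addHaar_closedBall _ _ (by positivity), ENNReal.toReal_mul,
    ENNReal.toReal_ofReal (by positivity)]
  simp only [finrank_euclideanSpace, Fintype.card_fin, measureReal_def]
  ring

lemma meshSize_nonneg (T : Triangulation Ω) : 0 ≤ T.meshSize :=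
  Real.sSup_nonneg (by rintro _ ⟨K, -, rfl⟩; exact K.diam_nonneg)

/-- Each ball has area proportional to `h²` and carries weight `h_K²`, so the bound on `Σ h_K²` is
exactly what keeps the total at order `h²`. -/
lemma integral_norm_sub_gradient_le (hb : Bornology.IsBounded Ω)
    {G : Plane → Plane} {w : Plane → ℝ} {a b : ℝ} (hb0 : 0 ≤ b) (hC : ∑ K ∈ T₂, K.diam ^ 2 ≤ C₀)
    (hGw : Integrable (fun x => ‖G x - gradient w x‖ ^ 2) (volume.restrict Ω))
    (h : ∀ᵐ x ∂(volume.restrict Ω), ‖G x - gradient w x‖ ^ 2 ≤ a * T.meshSize ^ 2 +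
        b * ∑ K ∈ T₂, (Metric.closedBall K.A (2 * T.meshSize)).indicator (fun _ => K.diam ^ 2) x) :
    ∫ x in Ω, ‖G x - gradient w x‖ ^ 2 ≤
      (a * volume.real Ω + 4 * b * volume.real (Metric.ball (0 : Plane) 1) * C₀) *
        T.meshSize ^ 2 := by
  have : IsFiniteMeasure (volume.restrict Ω) := ⟨by simpa using hb.measure_lt_top⟩
  set β := volume.real (Metric.ball (0 : Plane) 1)
  have hβ : 0 ≤ β := measureReal_nonneg
  have hI := fun K : Triangle => integral_indicator_closedBall_le (Ω := Ω) K.A T.meshSize_nonneg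
    (sq_nonneg K.diam)
  have i1 : Integrable (fun _ : Plane => a * T.meshSize ^ 2) (volume.restrict Ω) :=
    integrable_const _
  have i2 : Integrable (fun x => b * ∑ K ∈ T₂,
      (Metric.closedBall K.A (2 * T.meshSize)).indicator (fun _ => K.diam ^ 2) x)
      (volume.restrict Ω) :=
    (integrable_finsetSum _ fun K _ => (hI K).1).const_mul b
  refine (integral_mono_ae hGw (i1.add i2) h).trans ?_
  rw [integral_add' i1 i2, integral_const_mul b, integral_finsetSum _ fun K _ => (hI K).1]
  have h1 : ∑ K ∈ T₂, ∫ x in Ω,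
      (Metric.closedBall K.A (2 * T.meshSize)).indicator (fun _ => K.diam ^ 2) x ≤
      4 * T.meshSize ^ 2 * β * C₀ := by
    calc _ ≤ ∑ K ∈ T₂, 4 * T.meshSize ^ 2 * β * K.diam ^ 2 :=
          Finset.sum_le_sum fun K _ => (hI K).2
      _ = 4 * T.meshSize ^ 2 * β * ∑ K ∈ T₂, K.diam ^ 2 := by rw [Finset.mul_sum]
      _ ≤ _ := mul_le_mul_of_nonneg_left hC (by positivity)
  have h2 := mul_le_mul_of_nonneg_left h1 hb0
  have h3 : ∫ _ in Ω, a * T.meshSize ^ 2 = volume.real Ω * (a * T.meshSize ^ 2) := by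
    rw [setIntegral_const, smul_eq_mul]
  rw [h3]
  linarith

end Triangulation

/-! ### Assembly of the error estimate. -/

lemma exists_ae_norm_le_of_memLp_top {E : Type*} [NormedAddCommGroup E] {μ : Measure Plane}
    {f : Plane → E} (hf : MemLp f ∞ μ) : ∃ C : ℝ, 0 ≤ C ∧ ∀ᵐ x ∂μ, ‖f x‖ ≤ C := by
  refine ⟨(eLpNorm f ∞ μ).toReal, ENNReal.toReal_nonneg, ?_⟩
  have h := ae_le_eLpNormEssSup (f := f) (μ := μ)
  filter_upwards [h] with x hx
  rw [← eLpNorm_exponent_top] at hx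
  rw [← toReal_enorm]
  exact ENNReal.toReal_mono hf.2.ne hx

end FEM

theorem theorem3p3 (Ω : Set FEM.Plane) (hΩ_open : IsOpen Ω) (hΩ_conn : IsConnected Ω)
    (hΩ_bdd : Bornology.IsBounded Ω) (hΩ_reg : interior (closure Ω) = Ω)
    (α₀ : ℝ) (hα₀ : α₀ < Real.pi) (C₀ : ℝ)
    (f u : FEM.Plane → ℝ) (hf : MemLp f 2 (volume.restrict Ω))
    (hu : FEM.MemW2Inf Ω u) (hu_cont : ContinuousOn u (closure Ω))
    (huf : FEM.IsWeakSolution Ω f u) :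
    ∃ C : ℝ, ∀ (T : FEM.Triangulation Ω) (T₂ : Finset FEM.Triangle), T₂ ⊆ T.elements →
      (∀ K ∈ T.elements, K ∉ T₂ → K.maxAngle ≤ α₀) →
      FEM.Triangulation.Separated T₂ C₀ →
      ∃ g₀ : FEM.Plane → ℝ, T.IsAdaptedDatum T₂ u C g₀ ∧
        ∀ g : FEM.Plane → ℝ, T.MemX g → Set.EqOn g g₀ (frontier Ω) →
          (∃ U : FEM.Plane → ℝ, T.IsFEMSolution f g U) ∧
          ∀ U : FEM.Plane → ℝ, T.IsFEMSolution f g U →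
            FEM.MemH1 Ω (fun x => u x - U x) ∧
              FEM.h1Seminorm Ω (fun x => u x - U x) ≤ C * T.meshSize := by
  have : IsFiniteMeasure (volume.restrict Ω) := ⟨by simpa using hΩ_bdd.measure_lt_top⟩
  obtain ⟨huI, G, hG, hGI, hH⟩ := hu
  choose H hHw hHI using hH
  choose M hM0 hM using fun i => FEM.exists_ae_norm_le_of_memLp_top (hHI i)
  have hG2 : MemLp G 2 (volume.restrict Ω) := hGI.mono_exponent le_top
  have hG1 : IntegrableOn G Ω := hGI.integrable le_top
  have hu1 : IntegrableOn u Ω := huI.integrable le_top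
  obtain ⟨κ, hκ, hκs⟩ := FEM.exists_pos_le_sin hα₀
  set m := max (M 0) (M 1) with hm
  have hm0 : 0 ≤ m := (hM0 0).trans (le_max_left _ _)
  have hMm : ∀ i, ∀ᵐ x ∂(volume.restrict Ω), ‖H i x‖ ≤ m := fun i => by
    filter_upwards [hM i] with x hx
    refine hx.trans ?_
    fin_cases i
    · exact le_max_left _ _
    · exact le_max_right _ _
  set L := 2 * m with hL
  have hL0 : 0 ≤ L := by positivity
  set A := (4 * L ^ 2 + 16 * L ^ 2 / κ ^ 2) * volume.real Ω +
    4 * (768 * L ^ 2 / κ ^ 2) * volume.real (Metric.ball (0 : FEM.Plane) 1) * C₀ with hA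
  -- `2 * L` covers the perturbation of the boundary datum, `√A` the energy error.
  refine ⟨2 * L + √A, fun T T₂ hT hang hS => ?_⟩
  obtain ⟨w, hw, hwG⟩ := FEM.Triangulation.exists_approx (u := u) (G := G) hΩ_open hL0 hκ hT
    (fun K hK hK2 => hκs _ K.pi_div_three_le_maxAngle (hang K hK hK2)) hS fun K hK => by
      obtain ⟨q, hq1, hq2⟩ := FEM.exists_gradient_approx hΩ_open isOpen_interior
        K.convex_carrier.interior (T.interior_carrier_subset hΩ_reg hK) K.interior_nonempty
        (K.isCompact_carrier.isBounded.subset interior_subset) hu1 hG hG1 hHw hMm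
        (hu_cont.mono (K.closure_interior.le.trans (T.carrier_subset hK)))
      rw [K.diam_interior] at hq1 hq2
      rw [K.closure_interior] at hq2
      exact ⟨q, (ae_restrict_iff' isOpen_interior.measurableSet).1 hq1, hq2⟩
  refine ⟨w, ⟨hw.memX, hw.interp, fun P hP K hK hPK => (hw.near P hP K hK hPK).trans ?_⟩,
    fun g hg hgw => ⟨FEM.Triangulation.exists_isFEMSolution hΩ_open hΩ_bdd hf hg, fun U hU => ?_⟩⟩
  · have := Real.sqrt_nonneg A
    nlinarith [mul_nonneg this (sq_nonneg K.diam)]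
  -- Since `g` and `w` agree on the boundary, `U - w` lies in `V_h`, as the comparison in Céa's
  -- lemma requires.
  · have hgw0 : FEM.MemH10 Ω (fun x => g x - w x) :=
      (hg.sub hw.memX).memH10 hΩ_open hΩ_bdd fun x hx => sub_eq_zero.2 (hgw hx)
    have hUw : T.MemV (fun x => U x - w x) := by
      refine ⟨hU.1.sub hw.memX, ?_⟩
      have := hU.2.1.2.add hΩ_open hgw0
      simpa using this
    obtain ⟨h1, h2⟩ := hU.h1Seminorm_sub_le hΩ_open hΩ_bdd huf hG hG2 hw.memX hUw
    refine ⟨h1, h2.trans ?_⟩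
    have hint := FEM.Triangulation.integral_norm_sub_gradient_le hΩ_bdd (by positivity)
      hS.sum_le (FEM.Triangulation.integrable_norm_sq_of_memLp
        (hG2.sub (hw.memX.memLp_gradient hΩ_open hΩ_bdd 2))) hwG
    have h3 := T.meshSize_nonneg
    calc _ ≤ √(A * T.meshSize ^ 2) := Real.sqrt_le_sqrt hint
      _ = √A * T.meshSize := by
        rw [Real.sqrt_mul' _ (sq_nonneg _), Real.sqrt_sq h3]
      _ ≤ _ := by nlinarith
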